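/- Let $A$ be a simple separable C$^*$-algebra (not necessarily unital) that is monotracial, i.e. $A$ has a unique tracial state $\tau_A$ and no unbounded (densely defined, lower semicontinuous) traces. Let $\alpha$ be an outer action of a finite abelian group $\Gamma$ on $A$, i.e. for $g\neq 1$ the automorphism $\alpha_g$ is not of the form $\mathrm{Ad}(u)$ for any unitary $u$ of the multiplier algebra $M(A)$. Let $M:=\pi_{\tau_A}(A)''$, where $\pi_{\tau_A}$ is the GNS representation of $\tau_A$, let $\tilde\alpha$ be the action of $\Gamma$ on $M$ induced by $\alpha$, so that $\tilde\alpha_g(\pi_{\tau_A}(a))=\pi_{\tau_A}(\alpha_g(a))$, let $\tau_M$ be the tracial state of $M$, and put $$N(\tilde\alpha):=\{g\in\Gamma \mid \tilde\alpha_g=\mathrm{Ad}(u)\text{ for some unitary } u\in M\}.$$ Assume that the characteristic invariant of $\tilde\alpha$ is trivial, i.e. $\tilde\alpha_g(v)=v$ for all $g\in\Gamma$, $h\in N(\tilde\alpha)$ and every unitary $v\in M$ with $\tilde\alpha_h=\mathrm{Ad}(v)$. Let $P_{N(\tilde\alpha)}$ be the (finite) set of minimal projections of the group algebra $\mathbb{C}N(\tilde\alpha)$.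 Call two probability measures $m,m'$ on $P_{N(\tilde\alpha)}$ equivalent if there is a character $\eta$ of $N(\tilde\alpha)$ with $m=m'\circ\partial(\eta)$, where $\partial(\eta)\big(\sum_h c_h h\big)=\sum_h\eta(h)c_h h$. The inner invariant $i(\tilde\alpha)$ is the equivalence class $[m_v]$ of the probability measure $m_v(p):=\tau_M(\Phi_v(p))$, where $v$ is a unitary representation of $N(\tilde\alpha)$ in $M$ with $\tilde\alpha_h=\mathrm{Ad}(v_h)$ for all $h\in N(\tilde\alpha)$, and $\Phi_v\big(\sum_h c_h h\big)=\sum_h c_hv_h$; this class does not depend on the choice of $v$. If $m$ is a probability measure on $P_{N(\tilde\alpha)}$ such that $i(\tilde\alpha)=[m]$, then $m$ has full support, i.e. $m(p)>0$ for every $p\in P_{N(\tilde\alpha)}$. -/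

import Mathlib

open scoped ComplexOrder ENNReal NNReal

noncomputable section

namespace OpAlg

/-! ### Traces, simplicity, outerness -/

/-- A tracial state on a (possibly non-unital) normed `*`-algebra: a positive linear functional
of norm one with the trace property. -/
structure IsTracialState {B : Type*} [NonUnitalNormedRing B] [StarRing B] [Module ℂ B]
    (φ : B →ₗ[ℂ] ℂ) : Prop where
  nonneg : ∀ b, 0 ≤ φ (star b * b)
  norm_eq_one : IsLUB {r : ℝ | ∃ b : B, ‖b‖ ≤ 1 ∧ ‖φ b‖ = r} 1
  trace : ∀ a b, φ (a * b) = φ (b * a)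

section CStar

variable (A : Type*) [NonUnitalCStarAlgebra A]

/-- A C*-algebra is simple if it is non-zero and has no non-trivial closed two-sided ideals. -/
def IsSimpleCStar : Prop :=
  Nontrivial A ∧ ∀ I : TwoSidedIdeal A, IsClosed (I : Set A) → I = ⊥ ∨ I = ⊤

variable {A}

/-- A densely defined lower semicontinuous trace `A₊ → [0, ∞]`; only the values of `T` on the
positive cone matter. -/
structure IsTraceWeight [PartialOrder A] (T : A → ℝ≥0∞) : Prop where
  map_zero : T 0 = 0
  map_add : ∀ a b, 0 ≤ a → 0 ≤ b → T (a + b) = T a + T b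
  map_smul : ∀ (r : ℝ≥0) (a : A), 0 ≤ a → T (((r : ℝ) : ℂ) • a) = r * T a
  trace : ∀ x, T (star x * x) = T (x * star x)
  lsc : LowerSemicontinuousOn T {a | 0 ≤ a}
  dense : {a : A | 0 ≤ a} ⊆ closure {a | 0 ≤ a ∧ T a ≠ ∞}

variable (A) in
/-- `A` is monotracial: it has exactly one tracial state and no unbounded traces. -/
def IsMonotracial [PartialOrder A] : Prop :=
  (∃! τ : A →ₚ[ℂ] ℂ, IsTracialState τ.toLinearMap) ∧
    ∀ T : A → ℝ≥0∞, IsTraceWeight T → ∃ C : ℝ≥0, ∀ a, 0 ≤ a → T a ≤ C * ‖a‖₊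

/-- The unique tracial state `τ_A` of a monotracial C*-algebra. -/
def IsMonotracial.tau [PartialOrder A] (hA : IsMonotracial A) : A →ₚ[ℂ] ℂ := hA.1.choose

theorem IsMonotracial.tau_isTracialState [PartialOrder A] (hA : IsMonotracial A) :
    IsTracialState hA.tau.toLinearMap := hA.1.choose_spec.1

/-- An action is outer if `α_g` is implemented by a unitary of the multiplier algebra only for
`g = 1`. -/
def IsOuterAction {Γ : Type*} [Group Γ] (α : Γ →* (A ≃⋆ₐ[ℂ] A)) : Prop :=
  {g : Γ | ∃ u ∈ unitary (DoubleCentralizer ℂ A), ∀ a : A,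
    DoubleCentralizer.coe ℂ (α g a) = u * DoubleCentralizer.coe ℂ a * star u} = {1}

theorem invariant_inv [PartialOrder A] {τ : A →ₚ[ℂ] ℂ} {σ : A ≃⋆ₐ[ℂ] A}
    (h : ∀ a, τ (σ a) = τ a) (a : A) : τ (σ⁻¹ a) = τ a := by
  rw [← h (σ⁻¹ a), ← StarAlgEquiv.mul_apply, mul_inv_cancel, StarAlgEquiv.one_apply]

/-- By uniqueness, `τ_A` is invariant under every automorphism of `A`. -/
theorem IsMonotracial.tau_invariant [PartialOrder A] [StarOrderedRing A] (hA : IsMonotracial A)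
    (σ : A ≃⋆ₐ[ℂ] A) (a : A) : hA.tau (σ a) = hA.tau a := by
  let ρ : A →ₚ[ℂ] ℂ := PositiveLinearMap.mk₀
    { toFun := fun x => hA.tau (σ x), map_add' := by simp, map_smul' := by simp } (by
      intro x hx
      exact map_nonneg hA.tau (map_nonneg σ hx))
  have hρ : IsTracialState ρ.toLinearMap := by
    have ht := hA.tau_isTracialState
    refine ⟨fun b => ?_, ?_, fun a b => ?_⟩
    · have := ht.nonneg (σ b)
      rwa [← map_star, ← map_mul] at this
    · convert ht.norm_eq_one using 1
      ext r
      constructor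
      · rintro ⟨b, hb, rfl⟩
        exact ⟨σ b, by rwa [StarAlgEquiv.norm_map], rfl⟩
      · rintro ⟨b, hb, rfl⟩
        refine ⟨σ.symm b, by rwa [StarAlgEquiv.norm_map], ?_⟩
        change ‖hA.tau (σ (σ.symm b))‖ = _
        rw [StarAlgEquiv.apply_symm_apply]
        rfl
    · change hA.tau (σ (a * b)) = hA.tau (σ (b * a))
      rw [map_mul σ, map_mul σ]
      exact ht.trace _ _
  have : ρ = hA.tau := hA.1.unique hρ hA.tau_isTracialState
  exact congrArg (fun f : A →ₚ[ℂ] ℂ => f a) this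

end CStar

/-! ### The von Neumann algebra `π_τ(A)''` and the induced action -/

section GNS

variable {A : Type*} [NonUnitalCStarAlgebra A] [PartialOrder A] [StarOrderedRing A]

/-- `π_τ(A)''`, the bicommutant of the image of the GNS representation. -/
def gnsVN (τ : A →ₚ[ℂ] ℂ) : VonNeumannAlgebra τ.GNS where
  toStarSubalgebra := StarSubalgebra.centralizer ℂ
    (StarSubalgebra.centralizer ℂ (Set.range τ.gnsNonUnitalStarAlgHom) : Set (τ.GNS →L[ℂ] τ.GNS))
  centralizer_centralizer' := by
    change Set.centralizer (Set.centralizer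
      ((StarSubalgebra.centralizer ℂ (StarSubalgebra.centralizer ℂ
        (Set.range τ.gnsNonUnitalStarAlgHom) : Set (τ.GNS →L[ℂ] τ.GNS))) :
          Set (τ.GNS →L[ℂ] τ.GNS))) = ((StarSubalgebra.centralizer ℂ (StarSubalgebra.centralizer ℂ
        (Set.range τ.gnsNonUnitalStarAlgHom) : Set (τ.GNS →L[ℂ] τ.GNS))) :
          Set (τ.GNS →L[ℂ] τ.GNS))
    rw [StarSubalgebra.coe_centralizer_centralizer, Set.centralizer_centralizer_centralizer]

theorem coe_gnsVN (τ : A →ₚ[ℂ] ℂ) : ((gnsVN τ).toStarSubalgebra : Set (τ.GNS →L[ℂ] τ.GNS)) =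
    (Set.range τ.gnsNonUnitalStarAlgHom).centralizer.centralizer := by
  change ((StarSubalgebra.centralizer ℂ (StarSubalgebra.centralizer ℂ
        (Set.range τ.gnsNonUnitalStarAlgHom) : Set (τ.GNS →L[ℂ] τ.GNS))) :
          Set (τ.GNS →L[ℂ] τ.GNS)) = _
  rw [StarSubalgebra.coe_centralizer_centralizer]
  congr 2
  apply Set.union_eq_self_of_subset_right
  rintro x ⟨a, ha⟩
  exact ⟨star a, by rw [map_star, ha, star_star]⟩

/-- The isometry `[a] ↦ [σ a]` of the pre-Hilbert space of `τ`, for a `τ`-preserving `σ`. -/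
def preGNSMap (τ : A →ₚ[ℂ] ℂ) (σ : A ≃⋆ₐ[ℂ] A) (h : ∀ a, τ (σ a) = τ a) :
    τ.PreGNS →ₗᵢ[ℂ] τ.PreGNS where
  toFun x := τ.toPreGNS (σ (τ.ofPreGNS x))
  map_add' x y := by simp
  map_smul' c x := by simp
  norm_map' x := by
    simp only [PositiveLinearMap.preGNS_norm_def, LinearMap.coe_mk, AddHom.coe_mk,
      PositiveLinearMap.ofPreGNS_toPreGNS]
    rw [← map_star, ← map_mul, h]

/-- The isometry of the GNS Hilbert space extending `[a] ↦ [σ a]`. -/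
def gnsMap (τ : A →ₚ[ℂ] ℂ) (σ : A ≃⋆ₐ[ℂ] A) (h : ∀ a, τ (σ a) = τ a) :
    τ.GNS →L[ℂ] τ.GNS :=
  (preGNSMap τ σ h).toContinuousLinearMap.completion

@[simp] theorem gnsMap_coe (τ : A →ₚ[ℂ] ℂ) (σ : A ≃⋆ₐ[ℂ] A) (h : ∀ a, τ (σ a) = τ a)
    (x : τ.PreGNS) :
    gnsMap τ σ h (x : τ.GNS) = ((τ.toPreGNS (σ (τ.ofPreGNS x)) : τ.PreGNS) : τ.GNS) := by
  simp [gnsMap, preGNSMap]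

theorem norm_gnsMap (τ : A →ₚ[ℂ] ℂ) (σ : A ≃⋆ₐ[ℂ] A) (h : ∀ a, τ (σ a) = τ a)
    (x : τ.GNS) : ‖gnsMap τ σ h x‖ = ‖x‖ := by
  induction x using UniformSpace.Completion.induction_on with
  | hp => exact isClosed_eq (by fun_prop) (by fun_prop)
  | ih x =>
    rw [gnsMap_coe, UniformSpace.Completion.norm_coe, UniformSpace.Completion.norm_coe]
    exact (preGNSMap τ σ h).norm_map x

theorem gnsMap_gnsMap (τ : A →ₚ[ℂ] ℂ) (σ ρ : A ≃⋆ₐ[ℂ] A) (hσ : ∀ a, τ (σ a) = τ a)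
    (hρ : ∀ a, τ (ρ a) = τ a) (hσρ : ∀ a, τ ((σ * ρ) a) = τ a) (x : τ.GNS) :
    gnsMap τ σ hσ (gnsMap τ ρ hρ x) = gnsMap τ (σ * ρ) hσρ x := by
  induction x using UniformSpace.Completion.induction_on with
  | hp => exact isClosed_eq (by fun_prop) (by fun_prop)
  | ih x => simp

theorem gnsMap_one (τ : A →ₚ[ℂ] ℂ) (h : ∀ a, τ ((1 : A ≃⋆ₐ[ℂ] A) a) = τ a) (x : τ.GNS) :
    gnsMap τ 1 h x = x := by
  induction x using UniformSpace.Completion.induction_on with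
  | hp => exact isClosed_eq (by fun_prop) (by fun_prop)
  | ih x => simp

/-- The unitary `U_σ` of the GNS Hilbert space with `U_σ [a] = [σ a]`. -/
def gnsUnitary (τ : A →ₚ[ℂ] ℂ) (σ : A ≃⋆ₐ[ℂ] A) (h : ∀ a, τ (σ a) = τ a) :
    τ.GNS ≃ₗᵢ[ℂ] τ.GNS where
  toLinearEquiv := LinearEquiv.ofLinearMap (gnsMap τ σ h : τ.GNS →ₗ[ℂ] τ.GNS)
    (gnsMap τ σ⁻¹ (invariant_inv h) : τ.GNS →ₗ[ℂ] τ.GNS)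
    (by
      ext x
      have h1 : ∀ a, τ ((σ * σ⁻¹) a) = τ a := by simp
      change gnsMap τ σ h (gnsMap τ σ⁻¹ (invariant_inv h) x) = x
      rw [gnsMap_gnsMap τ _ _ _ _ h1]
      simp only [mul_inv_cancel]
      exact gnsMap_one τ _ x)
    (by
      ext x
      have h1 : ∀ a, τ ((σ⁻¹ * σ) a) = τ a := by simp
      change gnsMap τ σ⁻¹ (invariant_inv h) (gnsMap τ σ h x) = x
      rw [gnsMap_gnsMap τ _ _ _ _ h1]
      simp only [inv_mul_cancel]
      exact gnsMap_one τ _ x)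
  norm_map' x := norm_gnsMap τ σ h x

theorem gnsUnitary_apply (τ : A →ₚ[ℂ] ℂ) (σ : A ≃⋆ₐ[ℂ] A) (h : ∀ a, τ (σ a) = τ a)
    (x : τ.GNS) : gnsUnitary τ σ h x = gnsMap τ σ h x := rfl

theorem gnsUnitary_conj (τ : A →ₚ[ℂ] ℂ) (σ : A ≃⋆ₐ[ℂ] A) (h : ∀ a, τ (σ a) = τ a) (a : A) :
    (gnsUnitary τ σ h).conjStarAlgEquiv (τ.gnsNonUnitalStarAlgHom a) =
      τ.gnsNonUnitalStarAlgHom (σ a) := by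
  suffices H : ∀ y, gnsMap τ σ h (τ.gnsNonUnitalStarAlgHom a y) =
      τ.gnsNonUnitalStarAlgHom (σ a) (gnsMap τ σ h y) by
    ext y
    obtain ⟨z, rfl⟩ := (gnsUnitary τ σ h).surjective y
    rw [LinearIsometryEquiv.conjStarAlgEquiv_apply_apply, LinearIsometryEquiv.symm_apply_apply]
    exact H z
  intro y
  induction y using UniformSpace.Completion.induction_on with
  | hp => exact isClosed_eq (by fun_prop) (by fun_prop)
  | ih y => simp

theorem conj_mem_centralizer {B : Type*} [Mul B] {S : Set B} (e : B ≃* B) (he : e '' S = S)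
    {x : B} (hx : x ∈ S.centralizer) : e x ∈ S.centralizer := by
  intro s hs
  rw [← he] at hs
  obtain ⟨t, ht, rfl⟩ := hs
  rw [← map_mul, ← map_mul, hx t ht]

theorem image_centralizer {B : Type*} [Mul B] {S : Set B} (e : B ≃* B) (he : e '' S = S) :
    e '' S.centralizer = S.centralizer := by
  have he' : e.symm '' S = S := by
    conv_lhs => rw [← he]
    rw [Set.image_image]
    simp
  apply Set.Subset.antisymm
  · rintro _ ⟨x, hx, rfl⟩
    exact conj_mem_centralizer e he hx
  · intro x hx
    exact ⟨e.symm x, conj_mem_centralizer e.symm he' hx, by simp⟩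

theorem gnsUnitary_conj_mem (τ : A →ₚ[ℂ] ℂ) (σ : A ≃⋆ₐ[ℂ] A) (h : ∀ a, τ (σ a) = τ a)
    {x : τ.GNS →L[ℂ] τ.GNS} (hx : x ∈ (gnsVN τ).toStarSubalgebra) :
    (gnsUnitary τ σ h).conjStarAlgEquiv x ∈ (gnsVN τ).toStarSubalgebra := by
  rw [← SetLike.mem_coe, coe_gnsVN] at hx ⊢
  let e : (τ.GNS →L[ℂ] τ.GNS) ≃* (τ.GNS →L[ℂ] τ.GNS) :=
    ((gnsUnitary τ σ h).conjStarAlgEquiv : (τ.GNS →L[ℂ] τ.GNS) ≃⋆ₐ[ℂ] _)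
  refine conj_mem_centralizer e (image_centralizer e ?_) hx
  ext y
  constructor
  · rintro ⟨_, ⟨a, rfl⟩, rfl⟩
    exact ⟨σ a, (gnsUnitary_conj τ σ h a).symm⟩
  · rintro ⟨a, rfl⟩
    refine ⟨_, ⟨σ.symm a, rfl⟩, (gnsUnitary_conj τ σ h _).trans ?_⟩
    rw [StarAlgEquiv.apply_symm_apply]

theorem gnsUnitary_mul_conj (τ : A →ₚ[ℂ] ℂ) (σ ρ : A ≃⋆ₐ[ℂ] A) (hσ : ∀ a, τ (σ a) = τ a)
    (hρ : ∀ a, τ (ρ a) = τ a) (hσρ : ∀ a, τ ((σ * ρ) a) = τ a) (x : τ.GNS →L[ℂ] τ.GNS) :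
    (gnsUnitary τ (σ * ρ) hσρ).conjStarAlgEquiv x =
      (gnsUnitary τ σ hσ).conjStarAlgEquiv ((gnsUnitary τ ρ hρ).conjStarAlgEquiv x) := by
  have : gnsUnitary τ (σ * ρ) hσρ = (gnsUnitary τ ρ hρ).trans (gnsUnitary τ σ hσ) := by
    ext y
    rw [LinearIsometryEquiv.trans_apply, gnsUnitary_apply, gnsUnitary_apply, gnsUnitary_apply,
      gnsMap_gnsMap τ σ ρ hσ hρ hσρ]
  rw [this, LinearIsometryEquiv.conjStarAlgEquiv_trans, StarAlgEquiv.trans_apply]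

theorem gnsUnitary_one_conj (τ : A →ₚ[ℂ] ℂ) (h : ∀ a, τ ((1 : A ≃⋆ₐ[ℂ] A) a) = τ a)
    (x : τ.GNS →L[ℂ] τ.GNS) : (gnsUnitary τ 1 h).conjStarAlgEquiv x = x := by
  have : gnsUnitary τ 1 h = LinearIsometryEquiv.refl ℂ τ.GNS := by
    ext y
    exact gnsMap_one τ h y
  rw [this]
  rfl

/-- The restriction of an automorphism to a `*`-subalgebra which it leaves invariant. -/
def restrictAut {B : Type*} [Ring B] [StarRing B] [Algebra ℂ B] [StarModule ℂ B]
    (S : StarSubalgebra ℂ B) (e : B ≃⋆ₐ[ℂ] B) (he : ∀ x ∈ S, e x ∈ S)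
    (he' : ∀ x ∈ S, e.symm x ∈ S) : S ≃⋆ₐ[ℂ] S where
  toFun x := ⟨e x, he x x.2⟩
  invFun x := ⟨e.symm x, he' x x.2⟩
  left_inv x := by simp
  right_inv x := by simp
  map_mul' x y := Subtype.ext (map_mul e (x : B) y)
  map_add' x y := Subtype.ext (map_add e (x : B) y)
  map_smul' c x := Subtype.ext (map_smul e c (x : B))
  map_star' x := Subtype.ext (map_star e (x : B))

/-- The action `α̃` induced by a `τ`-preserving action `α` on `π_τ(A)''`: `α̃_g` is the restriction
of `x ↦ U_g x U_g*`, so that `α̃_g (π_τ a) = π_τ (α_g a)`. -/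
def inducedAction {Γ : Type*} [Group Γ] (τ : A →ₚ[ℂ] ℂ) (α : Γ →* (A ≃⋆ₐ[ℂ] A))
    (h : ∀ g a, τ (α g a) = τ a) :
    Γ →* ((gnsVN τ).toStarSubalgebra ≃⋆ₐ[ℂ] (gnsVN τ).toStarSubalgebra) where
  toFun g := restrictAut (gnsVN τ).toStarSubalgebra (gnsUnitary τ (α g) (h g)).conjStarAlgEquiv
    (fun _ hx => gnsUnitary_conj_mem τ (α g) (h g) hx)
    (fun _ hx => gnsUnitary_conj_mem τ (α g)⁻¹ (invariant_inv (h g)) hx)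
  map_one' := by
    ext x : 1
    apply Subtype.ext
    have key : ∀ (σ : A ≃⋆ₐ[ℂ] A) (hσ : ∀ a, τ (σ a) = τ a), σ = 1 →
        (gnsUnitary τ σ hσ).conjStarAlgEquiv (x : τ.GNS →L[ℂ] τ.GNS) = x := by
      rintro σ hσ rfl
      exact gnsUnitary_one_conj τ hσ x
    exact key (α 1) (h 1) (map_one α)
  map_mul' g k := by
    ext x : 1
    apply Subtype.ext
    have key : ∀ (σ : A ≃⋆ₐ[ℂ] A) (hσ : ∀ a, τ (σ a) = τ a), σ = α g * α k →
        (gnsUnitary τ σ hσ).conjStarAlgEquiv (x : τ.GNS →L[ℂ] τ.GNS) =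
          (gnsUnitary τ (α g) (h g)).conjStarAlgEquiv
            ((gnsUnitary τ (α k) (h k)).conjStarAlgEquiv x) := by
      rintro σ hσ rfl
      exact gnsUnitary_mul_conj τ (α g) (α k) (h g) (h k) hσ x
    exact key (α (g * k)) (h (g * k)) (map_mul α g k)

end GNS

/-! ### Inner invariants of actions on unital `*`-algebras -/

section Inner

variable {M : Type*} [Ring M] [StarRing M] [Algebra ℂ M] [StarModule ℂ M]
variable {Γ : Type*} [CommGroup Γ]

/-- `δ_g = Ad u`, i.e. `δ_g x = u x u*` for all `x`. -/
def Implements (δ : Γ →* (M ≃⋆ₐ[ℂ] M)) (u : unitary M) (g : Γ) : Prop :=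
  ∀ x : M, δ g x = u * x * star (u : M)

/-- `N(δ)`: the subgroup of those `g` for which `δ_g` is inner. -/
def innerSubgroup (δ : Γ →* (M ≃⋆ₐ[ℂ] M)) : Subgroup Γ where
  carrier := {g | ∃ u : unitary M, Implements δ u g}
  one_mem' := ⟨1, fun x => by simp⟩
  mul_mem' := by
    rintro g k ⟨u, hu⟩ ⟨w, hw⟩
    refine ⟨u * w, fun x => ?_⟩
    rw [map_mul, StarAlgEquiv.mul_apply, hw, hu]
    simp [mul_assoc]
  inv_mem' := by
    rintro g ⟨u, hu⟩
    refine ⟨star u, fun x => ?_⟩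
    apply (δ g).injective
    have h1 : δ g (δ g⁻¹ x) = x := by
      rw [← StarAlgEquiv.mul_apply, ← map_mul, mul_inv_cancel, map_one, StarAlgEquiv.one_apply]
    have h2 : (u : M) * star (u : M) = 1 := Unitary.mul_star_self_of_mem u.2
    refine h1.trans ((hu _).trans ?_).symm
    simp only [Unitary.coe_star, star_star]
    calc (u : M) * (star (u : M) * x * u) * star (u : M)
        = ((u : M) * star (u : M)) * x * ((u : M) * star (u : M)) := by simp only [mul_assoc]
      _ = x := by rw [h2, one_mul, mul_one]

/-- The characteristic invariant of `δ` is trivial. For a factor `M`, a unitary `v` with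
`δ_h = Ad v` satisfies `δ_g v = λ(g, h) v` for a scalar `λ(g, h)` not depending on the choice of
`v`; triviality means that `λ(g, h) = 1` for all `g ∈ Γ` and `h ∈ N(δ)`. -/
def HasTrivialCharInvariant (δ : Γ →* (M ≃⋆ₐ[ℂ] M)) : Prop :=
  ∀ (g : Γ), ∀ h ∈ innerSubgroup δ, ∀ v : unitary M, Implements δ v h → δ g (v : M) = v

end Inner

section GroupAlgebra

variable {N : Type*} [Group N]

/-- Projections of the group algebra `ℂN`: idempotents that are self-adjoint for the involution
`(∑ c_h h)* = ∑ conj(c_h) h⁻¹`. -/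
def IsGroupAlgProj (p : MonoidAlgebra ℂ N) : Prop :=
  p * p = p ∧ ∀ h : N, p.coeff h⁻¹ = star (p.coeff h)

/-- Minimal projections of `ℂN`: non-zero projections `p` such that the only projections `q ≤ p`
are `0` and `p`. -/
def IsMinimalProj (p : MonoidAlgebra ℂ N) : Prop :=
  IsGroupAlgProj p ∧ p ≠ 0 ∧ ∀ q, IsGroupAlgProj q → p * q = q → q = 0 ∨ q = p

variable (N) in
/-- The set `P_N` of minimal projections of `ℂN`. -/
def MinProj : Type _ := {p : MonoidAlgebra ℂ N // IsMinimalProj p}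

/-- The endomorphism `∂(η) (∑ c_h h) = ∑ η(h) c_h h` of `ℂN`. -/
def charHom (η : N →* Circle) : MonoidAlgebra ℂ N →ₐ[ℂ] MonoidAlgebra ℂ N :=
  MonoidAlgebra.lift ℂ (MonoidAlgebra ℂ N) N
    { toFun := fun h => MonoidAlgebra.single h (η h : ℂ)
      map_one' := by simp [MonoidAlgebra.one_def]
      map_mul' := fun h k => by simp [MonoidAlgebra.single_mul_single] }

@[simp] theorem charHom_single (η : N →* Circle) (h : N) (c : ℂ) :
    charHom η (MonoidAlgebra.single h c) = MonoidAlgebra.single h (η h * c) := by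
  simp [charHom, mul_comm]

theorem charHom_charHom (η θ : N →* Circle) (p : MonoidAlgebra ℂ N) :
    charHom η (charHom θ p) = charHom (η * θ) p := by
  have : (charHom η).comp (charHom θ) = charHom (η * θ) := by
    apply MonoidAlgebra.algHom_ext
    · intro h
      simp
    · ext
  exact congrArg (fun f : MonoidAlgebra ℂ N →ₐ[ℂ] MonoidAlgebra ℂ N => f p) this

theorem charHom_one (p : MonoidAlgebra ℂ N) : charHom (1 : N →* Circle) p = p := by
  have : charHom (1 : N →* Circle) = AlgHom.id ℂ _ := by
    apply MonoidAlgebra.algHom_ext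
    · intro h
      simp
    · ext
  exact congrArg (fun f : MonoidAlgebra ℂ N →ₐ[ℂ] MonoidAlgebra ℂ N => f p) this

theorem charHom_coeff (η : N →* Circle) (p : MonoidAlgebra ℂ N) (h : N) :
    (charHom η p).coeff h = η h * p.coeff h := by
  classical
  induction p using MonoidAlgebra.induction_linear with
  | zero => simp
  | add f g hf hg => simp [hf, hg, mul_add]
  | single k c =>
    rw [charHom_single, MonoidAlgebra.coeff_single, MonoidAlgebra.coeff_single,
      Finsupp.single_apply, Finsupp.single_apply]
    split_ifs with hk
    · rw [hk]
    · simp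

theorem IsGroupAlgProj.charHom {p : MonoidAlgebra ℂ N} (hp : IsGroupAlgProj p) (η : N →* Circle) :
    IsGroupAlgProj (charHom η p) := by
  refine ⟨by rw [← map_mul, hp.1], fun h => ?_⟩
  rw [charHom_coeff, charHom_coeff, hp.2, map_inv, Circle.coe_inv_eq_conj, star_mul']
  rfl

theorem IsMinimalProj.charHom {p : MonoidAlgebra ℂ N} (hp : IsMinimalProj p) (η : N →* Circle) :
    IsMinimalProj (charHom η p) := by
  have h1 : ∀ x : MonoidAlgebra ℂ N, OpAlg.charHom η (OpAlg.charHom η⁻¹ x) = x := fun x => by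
    rw [charHom_charHom, mul_inv_cancel, charHom_one]
  have h2 : ∀ x : MonoidAlgebra ℂ N, OpAlg.charHom η⁻¹ (OpAlg.charHom η x) = x := fun x => by
    rw [charHom_charHom, inv_mul_cancel, charHom_one]
  refine ⟨hp.1.charHom η, fun h0 => hp.2.1 ?_, fun q hq hpq => ?_⟩
  · rw [← h2 p, h0, map_zero]
  · have := hp.2.2 (OpAlg.charHom η⁻¹ q) (hq.charHom η⁻¹) (by
      conv_lhs => rw [← h2 p, ← map_mul, hpq])
    rcases this with h | h
    · left
      rw [← h1 q, h, map_zero]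
    · right
      rw [← h1 q, h]

/-- The action of a character `η` on `P_N` through `∂(η)`. -/
def MinProj.twist (η : N →* Circle) (p : MinProj N) : MinProj N :=
  ⟨charHom η p.1, p.2.charHom η⟩

variable (N) in
/-- The equivalence relation on probability measures on `P_N`: `m ∼ m'` if `m = m' ∘ ∂(η)` for
some character `η` of `N`. -/
def measureSetoid : Setoid (PMF (MinProj N)) where
  r m m' := ∃ η : N →* Circle, ∀ p, m p = m' (p.twist η)
  iseqv :=
    { refl := fun m => ⟨1, fun p => congrArg m (Subtype.ext (charHom_one p.1).symm)⟩
      symm := by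
        rintro m m' ⟨η, h⟩
        refine ⟨η⁻¹, fun p => ?_⟩
        rw [h]
        congr 1
        apply Subtype.ext
        simp only [MinProj.twist]
        rw [charHom_charHom, mul_inv_cancel, charHom_one]
      trans := by
        rintro m m' m'' ⟨η, h⟩ ⟨θ, k⟩
        refine ⟨θ * η, fun p => ?_⟩
        rw [h, k]
        congr 1
        apply Subtype.ext
        simp only [MinProj.twist]
        rw [charHom_charHom] }

end GroupAlgebra

section InnerInvariant

variable {M : Type*} [NormedRing M] [StarRing M] [Algebra ℂ M] [StarModule ℂ M]
variable {Γ : Type*} [CommGroup Γ]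

/-- The homomorphism `Φ_v : ℂN → M`, `∑ c_h h ↦ ∑ c_h v_h`, of a unitary representation `v`. -/
def groupAlgRep {N : Type*} [Group N] (v : N →* unitary M) : MonoidAlgebra ℂ N →ₐ[ℂ] M :=
  MonoidAlgebra.lift ℂ M N ((unitary M).subtype.comp v)

/-- `c = i(δ)`: the class `c` is the class `[m_v(δ)]` of the measure `m_v(δ)(p) = τ_M(Φ_v(p))`,
where `τ_M` is the tracial state of `M` and `v` is a unitary representation of `N(δ)` in `M` with
`δ_h = Ad v_h` for all `h ∈ N(δ)`. -/
def IsInnerInvariant (δ : Γ →* (M ≃⋆ₐ[ℂ] M))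
    (c : Quotient (measureSetoid (innerSubgroup δ))) : Prop :=
  ∃ (τM : M →ₗ[ℂ] ℂ) (v : innerSubgroup δ →* unitary M) (mv : PMF (MinProj (innerSubgroup δ))),
    IsTracialState τM ∧ (∀ h, Implements δ (v h) (h : Γ)) ∧
    (∀ p, τM (groupAlgRep v p.1) = ((mv p).toReal : ℂ)) ∧
    c = Quotient.mk (measureSetoid (innerSubgroup δ)) mv

end InnerInvariant

end OpAlg

end

open scoped ComplexOrder ENNReal NNReal

noncomputable section

/-! A measure `m` in the class `i(α̃)` is `m_v` twisted by a character, and `∂(η)` permutes the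
minimal projections, so it is enough that `τ_M(Φ_v(p)) ≠ 0` for every non-zero projection `p` of
`ℂN(α̃)`. This rests on two facts.

First, `Φ_v(p) ≠ 0`, because the unitaries `v_h` are linearly independent over `A`
(`IsMonotracial.eq_zero_of_sum_gnsHom_mul_eq_zero`). In a relation `∑ π(a_h) v_h = 0` of minimal
length with two non-zero coefficients `a_{h₀}`, `a_{h₁}`, the commutation rule `v_h π(x) = π(α_h x)
v_h` produces shorter relations, which must be trivial. They say that `π(a_{h₁}) v_g`, with `g = h₁
h₀⁻¹`, intertwines like `π(a_{h₀})`; since `M` is a factor, the two are proportional. Hence `v_g*`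
carries a non-zero element of `π(A)` into `π(A)`. By simplicity this extends to all of `π(A)`, so
`v_g` comes from a unitary multiplier of `A` implementing `α_g`, against outerness.

Second, no tracial state of `M` vanishes on a non-zero projection `e` of `M`. Normality of the state
is not assumed, so this is reduced to an algebraic identity: `1 = ∑ y_i* y_i` for finitely many `y_i
∈ eM` (`HasTrivialCenter.exists_sum_star_mul_eq_one`). If `φ(e) = 0`, then Cauchy–Schwarz and the
trace property give `φ(1) = 0`, whence `φ = 0`. The `y_i` form an extreme point of a weakly compact
convex set of column contractions. In a factor, extremality leaves two cases: the column is an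
isometry, or it fills all `n` copies of `e`; the trace vector rules out the second for large `n`.

That `M` is a factor comes from uniqueness of the trace: a positive central element `z` defines the
positive trace `⟨ξ, z π(a) ξ⟩` on `A`, a multiple of `τ_A`. -/

namespace OpAlg

/-! ### Weak compactness and extreme points of column contractions -/

section Extreme

variable {H : Type*} [NormedAddCommGroup H] [InnerProductSpace ℂ H] [CompleteSpace H]

local notation "⟪" x ", " y "⟫" => inner ℂ x y

/-- The column contractions with entries `y i` in the commutant of `S` and `e y i = y i`. -/
def contractiveColumns (n : ℕ) (S : Set (H →L[ℂ] H)) (e : H →L[ℂ] H) :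
    Set (Fin n → H →L[ℂ] H) :=
  {y | (∀ s, ∑ i, ‖y i s‖ ^ 2 ≤ ‖s‖ ^ 2) ∧ (∀ i, ∀ c ∈ S, c * y i = y i * c) ∧
    ∀ i, e * y i = y i}

/-- The matrix coefficients of the elements of `contractiveColumns n S e`. -/
def columnForms (n : ℕ) (S : Set (H →L[ℂ] H)) (e : H →L[ℂ] H) : Set (Fin n → H → H → ℂ) :=
  {f | (∀ i t s s', f i t (s + s') = f i t s + f i t s') ∧
    (∀ i t (a : ℂ) s, f i t (a • s) = a * f i t s) ∧
    (∀ i t t' s, f i (t + t') s = f i t s + f i t' s) ∧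
    (∀ i (a : ℂ) t s, f i (a • t) s = star a * f i t s) ∧
    (∀ (t : Fin n → H) s, ‖∑ i, f i (t i) s‖ ^ 2 ≤ (∑ i, ‖t i‖ ^ 2) * ‖s‖ ^ 2) ∧
    (∀ i, ∀ c ∈ S, ∀ t s, f i (c.adjoint t) s = f i t (c s)) ∧
    ∀ i t s, f i (e.adjoint t) s = f i t s}

/-- Each condition is an equation or a weak inequality between finitely many values of `f`, hence
closed for pointwise convergence. This is why commutation and `e y_i = y_i` are written with
adjoints on the first argument. -/
theorem isClosed_columnForms (n : ℕ) (S : Set (H →L[ℂ] H)) (e : H →L[ℂ] H) :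
    IsClosed (columnForms n S e) := by
  simp only [columnForms, Set.ofPred_and, Set.ofPred_forall]
  refine .inter ?_ (.inter ?_ (.inter ?_ (.inter ?_ (.inter ?_ (.inter ?_ ?_))))) <;>
  · repeat' refine isClosed_iInter fun _ => ?_
    first
    | exact isClosed_eq (by fun_prop) (by fun_prop)
    | exact isClosed_le (by fun_prop) (by fun_prop)

theorem norm_le_of_mem_columnForms {n : ℕ} {S : Set (H →L[ℂ] H)} {e : H →L[ℂ] H}
    {f : Fin n → H → H → ℂ} (hf : f ∈ columnForms n S e) (i : Fin n) (t s : H) :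
    ‖f i t s‖ ≤ ‖t‖ * ‖s‖ := by
  classical
  obtain ⟨-, -, -, h4, h5, -, -⟩ := hf
  have h0 : ∀ j s, f j 0 s = 0 := fun j s => by simpa using h4 j 0 0 s
  have := h5 (Pi.single i t) s
  rw [Finset.sum_eq_single i, Finset.sum_eq_single i, Pi.single_eq_same, ← mul_pow] at this
  · exact (sq_le_sq₀ (by positivity) (by positivity)).1 this
  · intro j _ hj; simp [Pi.single_eq_of_ne hj]
  · simp
  · intro j _ hj; rw [Pi.single_eq_of_ne hj, h0]
  · simp

theorem isCompact_columnForms (n : ℕ) (S : Set (H →L[ℂ] H)) (e : H →L[ℂ] H) :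
    IsCompact (columnForms n S e) := by
  have : IsCompact (Set.univ.pi fun _ : Fin n => Set.univ.pi fun t : H => Set.univ.pi fun s : H =>
      Metric.closedBall (0 : ℂ) (‖t‖ * ‖s‖)) :=
    isCompact_univ_pi fun _ => isCompact_univ_pi fun _ => isCompact_univ_pi fun _ =>
      isCompact_closedBall _ _
  refine this.of_isClosed_subset (isClosed_columnForms n S e) fun f hf i _ t _ s _ => ?_
  simpa using norm_le_of_mem_columnForms hf i t s

theorem coeff_mem_columnForms {n : ℕ} {S : Set (H →L[ℂ] H)} {e : H →L[ℂ] H}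
    {y : Fin n → H →L[ℂ] H} (hy : y ∈ contractiveColumns n S e) :
    (fun i t s => ⟪t, y i s⟫) ∈ columnForms n S e := by
  obtain ⟨h1, h2, h3⟩ := hy
  refine ⟨fun i t s s' => by simp, fun i t a s => by simp,
    fun i t t' s => inner_add_left _ _ _, fun i a t s => inner_smul_left _ _ _,
    fun t s => ?_, fun i c hc t s => ?_, fun i t s => ?_⟩
  · have hb : ‖∑ i, ⟪t i, y i s⟫‖ ≤ ∑ i, ‖t i‖ * ‖y i s‖ :=
      (norm_sum_le _ _).trans (Finset.sum_le_sum fun i _ => norm_inner_le_norm _ _)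
    calc ‖∑ i, ⟪t i, y i s⟫‖ ^ 2 ≤ (∑ i, ‖t i‖ * ‖y i s‖) ^ 2 := by gcongr
      _ ≤ (∑ i, ‖t i‖ ^ 2) * ∑ i, ‖y i s‖ ^ 2 := Finset.sum_mul_sq_le_sq_mul_sq _ _ _
      _ ≤ _ := by gcongr; exact h1 s
  · refine (ContinuousLinearMap.adjoint_inner_left _ _ _).trans ?_
    exact congrArg (fun T : H →L[ℂ] H => ⟪t, T s⟫) (h2 i c hc)
  · refine (ContinuousLinearMap.adjoint_inner_left _ _ _).trans ?_
    exact congrArg (fun T : H →L[ℂ] H => ⟪t, T s⟫) (h3 i)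

/-- Each `f i` is a bounded sesquilinear form, so Riesz representation yields the operator. -/
theorem exists_coeff_eq_of_mem_columnForms {n : ℕ} {S : Set (H →L[ℂ] H)} {e : H →L[ℂ] H}
    {f : Fin n → H → H → ℂ} (hf : f ∈ columnForms n S e) :
    ∃ y ∈ contractiveColumns n S e, f = fun i t s => ⟪t, y i s⟫ := by
  have hb := norm_le_of_mem_columnForms hf
  obtain ⟨h1, h2, h3, h4, h5, h6, h7⟩ := hf
  let B : Fin n → H →L⋆[ℂ] H →L[ℂ] ℂ := fun i =>
    LinearMap.mkContinuous₂
      (LinearMap.mk₂'ₛₗ (starRingEnd ℂ) (RingHom.id ℂ) (f i) (h3 i) (h4 i) (h1 i)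
        (fun a t s => h2 i t a s)) 1
      (fun t s => by simpa using hb i t s)
  have hB : ∀ i t s, B i t s = f i t s := fun i t s => rfl
  let y : Fin n → H →L[ℂ] H := fun i =>
    (InnerProductSpace.continuousLinearMapOfBilin (B i)).adjoint
  have hy : ∀ i t s, ⟪t, y i s⟫ = f i t s := fun i t s => by
    rw [ContinuousLinearMap.adjoint_inner_right,
      InnerProductSpace.continuousLinearMapOfBilin_apply, hB]
  refine ⟨y, ⟨fun s => ?_, fun i c hc => ?_, fun i => ?_⟩, ?_⟩
  -- With `t_i = y_i s` the bound reads `q² ≤ q ‖s‖²` for `q = ∑ ‖y_i s‖²`.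
  · have := h5 (fun i => y i s) s
    simp only [← hy, inner_self_eq_norm_sq_to_K] at this
    set q := ∑ i, ‖y i s‖ ^ 2
    have hq : 0 ≤ q := by positivity
    have h' : ‖∑ i, (‖y i s‖ : ℂ) ^ 2‖ = q := by
      rw [← Complex.norm_of_nonneg hq]; simp [q]
    erw [h'] at this
    rcases hq.eq_or_lt with h0 | h0
    · rw [← h0]; positivity
    · rw [pow_two] at this
      exact le_of_mul_le_mul_left this h0
  · ext s
    refine ext_inner_left ℂ fun t => ?_
    change ⟪t, c (y i s)⟫ = ⟪t, y i (c s)⟫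
    rw [← ContinuousLinearMap.adjoint_inner_left, hy, hy, h6 i c hc]
  · ext s
    refine ext_inner_left ℂ fun t => ?_
    change ⟪t, e (y i s)⟫ = ⟪t, y i s⟫
    rw [← ContinuousLinearMap.adjoint_inner_left, hy, hy, h7 i]
  · ext i t s
    rw [hy]

/-- The forms are compact for the product topology by Tychonoff, so the Krein–Milman theorem
supplies an extreme point, which is carried back to operators. -/
theorem exists_extreme_contractiveColumns (n : ℕ) (S : Set (H →L[ℂ] H)) (e : H →L[ℂ] H) :
    ∃ y ∈ contractiveColumns n S e, ∀ d, y + d ∈ contractiveColumns n S e →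
      y - d ∈ contractiveColumns n S e → d = 0 := by
  have hne : (columnForms n S e).Nonempty :=
    ⟨_, coeff_mem_columnForms (y := 0) ⟨fun s => by simp, by simp, by simp⟩⟩
  obtain ⟨f, hf, hext⟩ := (isCompact_columnForms n S e).extremePoints_nonempty hne
  obtain ⟨y, hy, rfl⟩ := exists_coeff_eq_of_mem_columnForms hf
  refine ⟨y, hy, fun d h1 h2 => ?_⟩
  have := hext (coeff_mem_columnForms h1) (coeff_mem_columnForms h2)
    ⟨1 / 2, 1 / 2, by norm_num, by norm_num, by norm_num, by
      ext i t s
      simp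
      ring⟩
  ext i s
  refine ext_inner_left ℂ fun t => ?_
  have h := congrFun (congrFun (congrFun this i) t) s
  simpa [inner_add_right] using h

end Extreme

/-! ### Comparison of projections in a factor -/

section Factor

variable {H : Type*} [NormedAddCommGroup H] [InnerProductSpace ℂ H] [CompleteSpace H]

local notation "⟪" x ", " y "⟫" => inner ℂ x y

theorem starProjection_commute {L : Submodule ℂ H} [L.HasOrthogonalProjection] {T : H →L[ℂ] H}
    (h1 : ∀ s ∈ L, T s ∈ L) (h2 : ∀ s ∈ L, T.adjoint s ∈ L) :
    T * L.starProjection = L.starProjection * T := by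
  have key : ∀ R : H →L[ℂ] H, (∀ s ∈ L, R s ∈ L) →
      L.starProjection * (R * L.starProjection) = R * L.starProjection := fun R hR => by
    ext s
    exact Submodule.starProjection_eq_self_iff.2 (hR _ (Submodule.starProjection_apply_mem L s))
  have hP : star L.starProjection = L.starProjection := isSelfAdjoint_starProjection L
  have k1 := key T h1
  have k2 := congrArg star (key (star T) h2)
  simp only [star_mul, hP, star_star, mul_assoc] at k2
  rw [← k1, k2]

/-- The trivial centre condition for a von Neumann algebra. -/
def HasTrivialCenter (M : VonNeumannAlgebra H) : Prop :=
  ∀ z ∈ M, z ∈ M.commutant → ∃ c : ℂ, z = c • 1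

/-- The subspace `{s | x M s = 0}` is invariant under `M` and under its commutant, so its projection
is central and therefore scalar. It contains the range of `y`; if `y ≠ 0` it is the whole space, and
then `x = 0`. -/
theorem HasTrivialCenter.eq_zero_or_eq_zero {M : VonNeumannAlgebra H} (hM : HasTrivialCenter M)
    {x y : H →L[ℂ] H} (hx : x ∈ M) (h : ∀ c ∈ M, x * c * y = 0) : x = 0 ∨ y = 0 := by
  let L : Submodule ℂ H := ⨅ c : M, (x * (c : H →L[ℂ] H)).ker
  have hL : ∀ s, s ∈ L ↔ ∀ c ∈ M, x (c s) = 0 := fun s => by simp [L, Submodule.mem_iInf]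
  have hcl : IsClosed (L : Set H) := by
    have : (L : Set H) = ⋂ c : M, {s | (x * (c : H →L[ℂ] H)) s = 0} := by
      ext s; simp [hL]
    rw [this]
    exact isClosed_iInter fun c => isClosed_eq (by fun_prop) (by fun_prop)
  have : CompleteSpace L := hcl.completeSpace_coe
  have inv1 : ∀ g ∈ M, ∀ s ∈ L, g s ∈ L := fun g hg s hs =>
    (hL _).2 fun c hc => (hL s).1 hs (c * g) (mul_mem hc hg)
  have inv2 : ∀ g ∈ M.commutant, ∀ s ∈ L, g s ∈ L := fun g hg s hs => by
    rw [hL]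
    intro c hc
    rw [VonNeumannAlgebra.mem_commutant_iff] at hg
    have e1 : c (g s) = g (c s) := congrArg (fun T : H →L[ℂ] H => T s) (hg c hc)
    have e2 : x (g (c s)) = g (x (c s)) := congrArg (fun T : H →L[ℂ] H => T (c s)) (hg x hx)
    rw [e1, e2, (hL s).1 hs c hc, map_zero]
  obtain ⟨c, hc⟩ := hM L.starProjection
    (by
      rw [← VonNeumannAlgebra.commutant_commutant M, VonNeumannAlgebra.mem_commutant_iff]
      exact fun g hg => starProjection_commute (inv2 g hg) (inv2 (star g) (star_mem hg)))
    (by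
      rw [VonNeumannAlgebra.mem_commutant_iff]
      exact fun g hg => starProjection_commute (inv1 g hg) (inv1 (star g) (star_mem hg)))
  by_contra! hne
  obtain ⟨s, hs⟩ : ∃ s, y s ≠ 0 := by
    by_contra! h0
    exact hne.2 (ContinuousLinearMap.ext h0)
  have hyL : y s ∈ L := (hL _).2 fun c hc => congrArg (fun T : H →L[ℂ] H => T s) (h c hc)
  have h1 : c • y s = y s := by
    have := Submodule.starProjection_eq_self_iff.2 hyL
    rwa [hc] at this
  have hc1 : c = 1 := by
    have : (c - 1) • y s = 0 := by rw [sub_smul, h1, one_smul, sub_self]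
    exact sub_eq_zero.1 ((smul_eq_zero.1 this).resolve_right hs)
  apply hne.1
  ext t
  have ht : t ∈ L := by
    rw [← Submodule.starProjection_eq_self_iff, hc, hc1]
    simp
  exact (hL t).1 ht 1 (one_mem M)

theorem sum_norm_sq_eq {n : ℕ} (y : Fin n → H →L[ℂ] H) (s : H) :
    ∑ i, ‖y i s‖ ^ 2 = (⟪s, (∑ i, star (y i) * y i) s⟫).re := by
  simp only [sum_apply, inner_sum, Complex.re_sum]
  refine Finset.sum_congr rfl fun i _ => ?_
  rw [mul_apply_eq_comp, ContinuousLinearMap.star_eq_adjoint,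
    ContinuousLinearMap.adjoint_inner_right]
  exact (inner_self_eq_norm_sq (𝕜 := ℂ) _).symm

theorem isSelfAdjoint_sum_star_mul {n : ℕ} (y : Fin n → H →L[ℂ] H) :
    star (∑ i, star (y i) * y i) = ∑ i, star (y i) * y i := by
  simp [star_sum]

/-- An extreme column contraction is a partial isometry. -/
theorem extreme_mul_one_sub {n : ℕ} {S : Set (H →L[ℂ] H)} {e : H →L[ℂ] H}
    {y : Fin n → H →L[ℂ] H} (hS : ∀ c ∈ S, star c ∈ S) (hy : y ∈ contractiveColumns n S e)
    (hext : ∀ d, y + d ∈ contractiveColumns n S e → y - d ∈ contractiveColumns n S e → d = 0)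
    (i : Fin n) : y i * (1 - ∑ i, star (y i) * y i) = 0 := by
  obtain ⟨y1, y2, y3⟩ := hy
  set h := ∑ i, star (y i) * y i with hh
  have hsa : star h = h := isSelfAdjoint_sum_star_mul y
  have hcomm : ∀ c ∈ S, c * h = h * c := fun c hc => by
    rw [hh, Finset.mul_sum, Finset.sum_mul]
    refine Finset.sum_congr rfl fun j _ => ?_
    have := congrArg star (y2 j _ (hS c hc))
    simp only [star_mul, star_star] at this
    rw [← mul_assoc, ← this, mul_assoc, y2 j c hc, mul_assoc]
  have hsym : ∀ a b : H, (⟪a, h b⟫).re = (⟪b, h a⟫).re := fun a b => by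
    rw [← ContinuousLinearMap.adjoint_inner_left, ← ContinuousLinearMap.star_eq_adjoint, hsa,
      ← inner_conj_symm, Complex.conj_re]
  have hsym' : ∀ a b : H, (⟪h a, b⟫).re = (⟪b, h a⟫).re := fun a b => by
    rw [← inner_conj_symm, Complex.conj_re]
  have hnn : ∀ s, 0 ≤ (⟪s, h s⟫).re := fun s => by
    rw [hh, ← sum_norm_sq_eq]; positivity
  have hle : ∀ s, (⟪s, h s⟫).re ≤ (⟪s, s⟫).re := fun s => by
    rw [hh, ← sum_norm_sq_eq]
    exact (y1 s).trans_eq (inner_self_eq_norm_sq (𝕜 := ℂ) s).symm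
  have hself : ∀ s : H, ‖s‖ ^ 2 = (⟪s, s⟫).re := fun s => (inner_self_eq_norm_sq (𝕜 := ℂ) s).symm
  have hsq : ∀ s, ∑ i, ‖y i s‖ ^ 2 = (⟪s, h s⟫).re := sum_norm_sq_eq y
  have hhalf : ‖(1 / 2 : ℂ)‖ ^ 2 = 1 / 4 := by norm_num
  -- The perturbed columns are `½ y (3 - h)` and `½ y (1 + h)`. They are contractions because `h (3
  -- - h)² ≤ 4` and `h (1 + h)² ≤ 4` for `0 ≤ h ≤ 1`; for instance `4 - h (3 - h)² = 3 (1 - h)² + (1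
  -- - h)³`. The inequalities are checked on quadratic forms, without functional calculus.
  have hd : (fun i => (1 / 2 : ℂ) • (y i * (1 - h))) = 0 := by
    refine hext _ ⟨fun s => ?_, fun i c hc => ?_, fun i => ?_⟩
      ⟨fun s => ?_, fun i c hc => ?_, fun i => ?_⟩
    · have e1 : ∀ i, (y + fun i => (1 / 2 : ℂ) • (y i * (1 - h))) i s =
          (1 / 2 : ℂ) • y i ((3 : ℂ) • s - h s) := fun i => by
        simp only [Pi.add_apply, add_apply, smul_apply,
          mul_apply_eq_comp, sub_apply,
          one_apply_eq_self, map_sub, map_smul]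
        module
      simp only [e1, norm_smul, mul_pow, hhalf, ← Finset.mul_sum, hsq, hself s]
      have := hnn (s - h s)
      have := hle (s - h s)
      have := (inner_self_nonneg (𝕜 := ℂ) (x := s - h s))
      simp only [map_sub, map_smul, inner_sub_left, inner_sub_right, inner_smul_left,
        inner_smul_right, Complex.sub_re, RCLike.re_to_complex, map_ofNat, Complex.mul_re,
        Complex.re_ofNat, Complex.im_ofNat, zero_mul, sub_zero, hsym s (h s), hsym' s] at *
      linarith
    · simp only [Pi.add_apply, mul_add, add_mul, mul_smul_comm, smul_mul_assoc]
      rw [← mul_assoc, y2 i c hc, mul_assoc, mul_assoc, mul_sub, sub_mul, mul_one, one_mul,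
        hcomm c hc]
    · simp only [Pi.add_apply, mul_add, mul_smul_comm, ← mul_assoc, y3 i]
    · have e1 : ∀ i, (y - fun i => (1 / 2 : ℂ) • (y i * (1 - h))) i s =
          (1 / 2 : ℂ) • y i (s + h s) := fun i => by
        simp only [Pi.sub_apply, smul_apply,
          mul_apply_eq_comp, sub_apply,
          one_apply_eq_self, map_sub, map_add]
        module
      simp only [e1, norm_smul, mul_pow, hhalf, ← Finset.mul_sum, hsq, hself s]
      have := hnn (s - h s)
      have := hle (h s)
      have := hle (s + h s)
      have := hle s
      simp only [map_sub, map_add, inner_sub_left, inner_sub_right, inner_add_left,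
        inner_add_right, Complex.sub_re, Complex.add_re, hsym s (h s), hsym' s] at *
      linarith
    · simp only [Pi.sub_apply, mul_sub, sub_mul, mul_smul_comm, smul_mul_assoc, mul_one]
      rw [← mul_assoc, y2 i c hc, mul_assoc, mul_assoc, hcomm c hc]
    · simp only [Pi.sub_apply, mul_sub, mul_smul_comm, ← mul_assoc, y3 i]
  have := congrFun hd i
  simpa using this

/-- In a factor, compare the unit with `n` copies of a projection `e`. -/
theorem HasTrivialCenter.exists_column {M : VonNeumannAlgebra H} (hM : HasTrivialCenter M) (n : ℕ)
    {e : H →L[ℂ] H} (he : e ∈ M) (hee : e * e = e) (hse : star e = e) :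
    ∃ y : Fin n → H →L[ℂ] H, (∀ i, y i ∈ M) ∧ (∀ i, e * y i = y i) ∧
      (∀ s, ∑ i, ‖y i s‖ ^ 2 ≤ ‖s‖ ^ 2) ∧
      (∑ i, star (y i) * y i = 1 ∨ ∀ i, y i * star (y i) = e) := by
  obtain ⟨y, hy, hext⟩ := exists_extreme_contractiveColumns n (M.commutant : Set (H →L[ℂ] H)) e
  have hmul := extreme_mul_one_sub (fun c hc => star_mem hc) hy hext
  obtain ⟨y1, y2, y3⟩ := hy
  have hyM : ∀ i, y i ∈ M := fun i => by
    rw [← VonNeumannAlgebra.commutant_commutant M, VonNeumannAlgebra.mem_commutant_iff]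
    exact y2 i
  refine ⟨y, hyM, y3, y1, ?_⟩
  set h := ∑ i, star (y i) * y i with hh
  have hhM : h ∈ M := sum_mem fun i _ => mul_mem (star_mem (hyM i)) (hyM i)
  have hsa : star h = h := isSelfAdjoint_sum_star_mul y
  have hsq : ∀ s, ∑ i, ‖y i s‖ ^ 2 = (⟪s, h s⟫).re := sum_norm_sq_eq y
  have hidem : h * (1 - h) = 0 := by
    conv_lhs => rw [hh, Finset.sum_mul]
    exact Finset.sum_eq_zero fun i _ => by rw [mul_assoc, hmul, mul_zero]
  have hidem' : (1 - h) * (1 - h) = 1 - h := by rw [sub_mul, one_mul, hidem, sub_zero]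
  have hpyth : ∀ s, ∑ i, ‖y i s‖ ^ 2 + ‖(1 - h) s‖ ^ 2 = ‖s‖ ^ 2 := fun s => by
    have e1 : ‖(1 - h) s‖ ^ 2 = (⟪s, (1 - h) s⟫).re := by
      have e0 : (1 - h) s = (1 - h) ((1 - h) s) :=
        (congrArg (fun T : H →L[ℂ] H => T s) hidem').symm
      conv_rhs => rw [e0]
      rw [← ContinuousLinearMap.adjoint_inner_left, ← ContinuousLinearMap.star_eq_adjoint, star_sub,
        star_one, hsa]
      exact (inner_self_eq_norm_sq (𝕜 := ℂ) ((1 - h) s)).symm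
    rw [e1, hsq, ← Complex.add_re, ← inner_add_right, ← add_apply,
      add_sub_cancel]
    exact inner_self_eq_norm_sq (𝕜 := ℂ) s
  by_cases h1 : 1 - h = 0
  · exact Or.inl (sub_eq_zero.1 h1).symm
  right
  intro i
  have hxM : e - y i * star (y i) ∈ M := sub_mem he (mul_mem (hyM i) (star_mem (hyM i)))
  refine (sub_eq_zero.1 ((hM.eq_zero_or_eq_zero hxM fun c hc => ?_).resolve_right h1)).symm
  classical
  -- `D` is the `i`-th column of `diag(e) - y y*` times `c (1 - h)`. It is supported on `1 - h`,
  -- where `y` vanishes, and its range is orthogonal to that of `y` (`y* D = 0`), so small multiples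
  -- of it can be added to and subtracted from `y` without losing contractivity.
  let D : Fin n → H →L[ℂ] H := fun j =>
    ((if j = i then e else 0) - y j * star (y i)) * c * (1 - h)
  have hDM : ∀ j, D j ∈ M := fun j => by
    refine mul_mem (mul_mem (sub_mem ?_ (mul_mem (hyM j) (star_mem (hyM i)))) hc)
      (sub_mem (one_mem M) hhM)
    split_ifs
    exacts [he, zero_mem M]
  have hDe : ∀ j, e * D j = D j := fun j => by
    simp only [D, ← mul_assoc]
    congr 2
    rw [mul_sub, ← mul_assoc, y3 j]
    split_ifs <;> simp [hee]
  have hDh : ∀ j, D j * (1 - h) = D j := fun j => by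
    simp only [D, mul_assoc, hidem']
  have hye : star (y i) * e = star (y i) := by
    have := congrArg star (y3 i)
    rwa [star_mul, hse] at this
  have hcross : ∑ j, star (y j) * D j = 0 := by
    have e1 : ∀ j, star (y j) * D j = (if j = i then star (y j) * e else 0) * (c * (1 - h)) -
        star (y j) * y j * (star (y i) * c * (1 - h)) := fun j => by
      simp only [D]
      split_ifs <;> noncomm_ring
    have e2 := congrArg star (hmul i)
    rw [star_mul, star_sub, star_one, hsa, star_zero, sub_mul, one_mul, sub_eq_zero] at e2
    rw [Finset.sum_congr rfl fun j _ => e1 j, Finset.sum_sub_distrib, ← Finset.sum_mul,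
      ← Finset.sum_mul, Finset.sum_ite_eq' Finset.univ i, if_pos (Finset.mem_univ i), hye, ← hh,
      ← mul_assoc h, ← mul_assoc h, ← e2, mul_assoc, sub_self]
  have hcross' : ∀ s, ∑ j, (⟪y j s, D j s⟫).re = 0 := fun s => by
    have : (⟪s, (∑ j, star (y j) * D j) s⟫).re = 0 := by rw [hcross]; simp
    rw [← this, sum_apply, inner_sum, Complex.re_sum]
    refine Finset.sum_congr rfl fun j _ => ?_
    rw [mul_apply_eq_comp (star (y j)), ContinuousLinearMap.star_eq_adjoint (y j),
      ContinuousLinearMap.adjoint_inner_right]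
  set κ : ℝ := ∑ j, ‖D j‖ ^ 2 with hκ
  have hκ0 : 0 ≤ κ := by positivity
  -- Any `t > 0` with `t² κ ≤ 1` would do; this choice also covers `κ = 0`.
  let t : ℝ := 1 / (1 + κ)
  have ht0 : 0 < t := by positivity
  have ht : t ^ 2 * κ ≤ 1 := by
    rw [div_pow, one_pow, div_mul_eq_mul_div, one_mul, div_le_one (by positivity)]
    nlinarith
  have hDs : ∀ s, ∑ j, ‖D j s‖ ^ 2 ≤ κ * ‖(1 - h) s‖ ^ 2 := fun s => by
    rw [hκ, Finset.sum_mul]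
    refine Finset.sum_le_sum fun j _ => ?_
    rw [← mul_pow]
    have : D j s = D j ((1 - h) s) := (congrArg (fun T : H →L[ℂ] H => T s) (hDh j)).symm
    rw [this]
    gcongr
    exact (D j).le_opNorm _
  have main : ∀ r : ℝ, r ^ 2 = t ^ 2 → ∀ s,
      ∑ j, ‖y j s + (r : ℂ) • D j s‖ ^ 2 ≤ ‖s‖ ^ 2 := fun r hr s => by
    have e1 : ∀ j, ‖y j s + (r : ℂ) • D j s‖ ^ 2 =
        ‖y j s‖ ^ 2 + 2 * (r * (⟪y j s, D j s⟫).re) + t ^ 2 * ‖D j s‖ ^ 2 := fun j => by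
      rw [norm_add_sq (𝕜 := ℂ), norm_smul, mul_pow, inner_smul_right, RCLike.re_to_complex,
        Complex.re_ofReal_mul, Complex.norm_real, Real.norm_eq_abs, sq_abs, hr]
    simp only [e1, Finset.sum_add_distrib, ← Finset.mul_sum, hcross', mul_zero, add_zero]
    rw [← hpyth s]
    gcongr
    calc t ^ 2 * ∑ j, ‖D j s‖ ^ 2 ≤ t ^ 2 * (κ * ‖(1 - h) s‖ ^ 2) := by gcongr; exact hDs s
      _ = t ^ 2 * κ * ‖(1 - h) s‖ ^ 2 := by ring
      _ ≤ _ := mul_le_of_le_one_left (by positivity) ht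
  have hDc : ∀ j, ∀ c ∈ M.commutant, c * D j = D j * c := fun j c hc =>
    ((VonNeumannAlgebra.mem_commutant_iff.1 hc) _ (hDM j)).symm
  have hD0 := hext (fun j => (t : ℂ) • D j)
    ⟨fun s => main t rfl s, fun j c hc => by simp [mul_add, add_mul, y2 j c hc, hDc j c hc],
      fun j => by simp [mul_add, y3 j, hDe]⟩
    ⟨fun s => by simpa [sub_eq_add_neg] using main (-t) (by ring) s,
      fun j c hc => by simp [mul_sub, sub_mul, y2 j c hc, hDc j c hc],
      fun j => by simp [mul_sub, y3 j, hDe]⟩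
  have := (smul_eq_zero.1 (congrFun hD0 i)).resolve_left (by exact_mod_cast ht0.ne')
  simpa [D] using this

/-- In a factor with a trace vector `ξ`, the unit is a finite sum `∑ y_i* y_i` with `e y_i = y_i`,
for every projection `e` with `e ξ ≠ 0`. -/
theorem HasTrivialCenter.exists_sum_star_mul_eq_one {M : VonNeumannAlgebra H}
    (hM : HasTrivialCenter M) {ξ : H} (hξ : ∀ x ∈ M, ‖star x ξ‖ = ‖x ξ‖)
    {e : H →L[ℂ] H} (he : e ∈ M) (hee : e * e = e) (hse : star e = e) (heξ : e ξ ≠ 0) :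
    ∃ (n : ℕ) (y : Fin n → H →L[ℂ] H), (∀ i, y i ∈ M) ∧ (∀ i, e * y i = y i) ∧
      ∑ i, star (y i) * y i = 1 := by
  have hpos : 0 < ‖e ξ‖ ^ 2 := by positivity
  -- If `y_i y_i* = e` for all `i`, the trace property gives `‖y_i ξ‖ = ‖e ξ‖`, so contractivity
  -- forces `n ‖e ξ‖² ≤ ‖ξ‖²`.
  obtain ⟨n, hn⟩ := exists_nat_gt (‖ξ‖ ^ 2 / ‖e ξ‖ ^ 2)
  rw [div_lt_iff₀ hpos] at hn
  obtain ⟨y, hy1, hy2, hy3, hy4⟩ := hM.exists_column n he hee hse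
  refine ⟨n, y, hy1, hy2, hy4.resolve_right fun h => ?_⟩
  have e1 : ∀ i, ‖y i ξ‖ ^ 2 = ‖e ξ‖ ^ 2 := fun i => by
    have key : ∀ z : H →L[ℂ] H, ‖z ξ‖ ^ 2 = (⟪ξ, (star z * z) ξ⟫).re := fun z => by
      rw [mul_apply_eq_comp, ContinuousLinearMap.star_eq_adjoint,
        ContinuousLinearMap.adjoint_inner_right]
      exact (inner_self_eq_norm_sq (𝕜 := ℂ) _).symm
    rw [← hξ _ (hy1 i), key, star_star, h i, key e, hse, hee]
  have := hy3 ξ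
  simp only [e1, Finset.sum_const, Finset.card_univ, Fintype.card_fin, nsmul_eq_mul] at this
  linarith

end Factor

/-! ### Proportionality of intertwiners by a projection on `H ⊕ H` -/

section Intertwine

variable {H : Type*} [NormedAddCommGroup H] [InnerProductSpace ℂ H]

/-- The inclusion of the first summand of `H ⊕ H`. -/
def hilbertInl : H →L[ℂ] WithLp 2 (H × H) :=
  ((WithLp.prodContinuousLinearEquiv 2 ℂ H H).symm : (H × H) →L[ℂ] WithLp 2 (H × H)) ∘L
    ContinuousLinearMap.inl ℂ H H

/-- The inclusion of the second summand of `H ⊕ H`. -/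
def hilbertInr : H →L[ℂ] WithLp 2 (H × H) :=
  ((WithLp.prodContinuousLinearEquiv 2 ℂ H H).symm : (H × H) →L[ℂ] WithLp 2 (H × H)) ∘L
    ContinuousLinearMap.inr ℂ H H

/-- The projection of `H ⊕ H` onto the first summand. -/
def hilbertFst : WithLp 2 (H × H) →L[ℂ] H :=
  ContinuousLinearMap.fst ℂ H H ∘L (WithLp.prodContinuousLinearEquiv 2 ℂ H H)

/-- The projection of `H ⊕ H` onto the second summand. -/
def hilbertSnd : WithLp 2 (H × H) →L[ℂ] H :=
  ContinuousLinearMap.snd ℂ H H ∘L (WithLp.prodContinuousLinearEquiv 2 ℂ H H)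

/-- The diagonal operator `d ⊕ d`. -/
def hilbertDiag (d : H →L[ℂ] H) : WithLp 2 (H × H) →L[ℂ] WithLp 2 (H × H) :=
  hilbertInl ∘L d ∘L hilbertFst + hilbertInr ∘L d ∘L hilbertSnd

@[simp] theorem hilbertFst_inl (s : H) : hilbertFst (hilbertInl s) = s := rfl
@[simp] theorem hilbertSnd_inl (s : H) : hilbertSnd (hilbertInl s) = 0 := rfl
@[simp] theorem hilbertFst_inr (s : H) : hilbertFst (hilbertInr s) = 0 := rfl
@[simp] theorem hilbertSnd_inr (s : H) : hilbertSnd (hilbertInr s) = s := rfl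

theorem hilbertInl_fst_add (x : WithLp 2 (H × H)) :
    hilbertInl (hilbertFst x) + hilbertInr (hilbertSnd x) = x := by
  apply (WithLp.equiv 2 (H × H)).injective
  change (x.fst + 0, 0 + x.snd) = (x.fst, x.snd)
  simp

@[simp] theorem hilbertFst_diag (d : H →L[ℂ] H) (x : WithLp 2 (H × H)) :
    hilbertFst (hilbertDiag d x) = d (hilbertFst x) := by
  simp [hilbertDiag]

@[simp] theorem hilbertSnd_diag (d : H →L[ℂ] H) (x : WithLp 2 (H × H)) :
    hilbertSnd (hilbertDiag d x) = d (hilbertSnd x) := by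
  simp [hilbertDiag]

@[simp] theorem hilbertDiag_inl (d : H →L[ℂ] H) (s : H) :
    hilbertDiag d (hilbertInl s) = hilbertInl (d s) := by
  simp [hilbertDiag]

@[simp] theorem hilbertDiag_inr (d : H →L[ℂ] H) (s : H) :
    hilbertDiag d (hilbertInr s) = hilbertInr (d s) := by
  simp [hilbertDiag]

variable [CompleteSpace H]

theorem adjoint_hilbertDiag (d : H →L[ℂ] H) :
    (hilbertDiag d).adjoint = hilbertDiag (d.adjoint) := by
  symm
  rw [ContinuousLinearMap.eq_adjoint_iff]
  intro x y
  have key : ∀ u v : WithLp 2 (H × H), inner ℂ u v =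
      inner ℂ (hilbertFst u) (hilbertFst v) + inner ℂ (hilbertSnd u) (hilbertSnd v) :=
    fun u v => WithLp.prod_inner_apply u v
  simp [key, ContinuousLinearMap.adjoint_inner_left]

/-- In a factor generated by `S`, elements with `y c a = a c y` for all `c ∈ S` are
proportional. -/
theorem HasTrivialCenter.eq_smul_of_forall_mul_mul_eq {M : VonNeumannAlgebra H}
    (hM : HasTrivialCenter M) {S : Set (H →L[ℂ] H)} (hSM : ∀ c ∈ S, c ∈ M)
    (hcomm : ∀ x, (∀ c ∈ S, c * x = x * c) → x ∈ M.commutant) (hstar : ∀ c ∈ S, star c ∈ S)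
    (hmul : ∀ c ∈ S, ∀ d ∈ S, c * d ∈ S) {a y : H →L[ℂ] H} (ha : a ∈ M) (hy : y ∈ M)
    (hsep : ∃ c ∈ S, a * c ≠ 0) (h : ∀ c ∈ S, y * c * a = a * c * y) :
    ∃ μ : ℂ, y = μ • a := by
  let T : (H →L[ℂ] H) → WithLp 2 (H × H) →L[ℂ] H := fun c =>
    (y * c) ∘L hilbertFst - (a * c) ∘L hilbertSnd
  -- `L` consists of the pairs `(s, t)` with `y c s = a c t` for all `c ∈ S`; by hypothesis it
  -- contains every `(a s, y s)`. It is invariant under `d ⊕ d` for `d` in `S` or in the commutant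
  -- of `M`, so the four matrix entries of its projection lie in the centre and are scalars.
  let L : Submodule ℂ (WithLp 2 (H × H)) := ⨅ c : S, (T c).ker
  have hL : ∀ x, x ∈ L ↔ ∀ c ∈ S, y (c (hilbertFst x)) = a (c (hilbertSnd x)) := fun x => by
    simp [L, T, Submodule.mem_iInf, sub_eq_zero]
  have hcl : IsClosed (L : Set (WithLp 2 (H × H))) := by
    have : (L : Set (WithLp 2 (H × H))) = ⋂ c : S, {x | T c x = 0} := by
      ext x; simp [L]
    rw [this]
    exact isClosed_iInter fun c => isClosed_eq (by fun_prop) (by fun_prop)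
  have : CompleteSpace L := hcl.completeSpace_coe
  set P := L.starProjection with hP
  have inv1 : ∀ d ∈ S, ∀ x ∈ L, hilbertDiag d x ∈ L := fun d hd x hx => by
    rw [hL] at hx ⊢
    intro c hc
    simpa using hx (c * d) (hmul c hc d hd)
  have inv2 : ∀ d ∈ M.commutant, ∀ x ∈ L, hilbertDiag d x ∈ L := fun d hd x hx => by
    rw [VonNeumannAlgebra.mem_commutant_iff] at hd
    have e : ∀ g ∈ M, ∀ s, g (d s) = d (g s) := fun g hg s =>
      congrArg (fun T : H →L[ℂ] H => T s) (hd g hg)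
    rw [hL] at hx ⊢
    intro c hc
    rw [hilbertFst_diag, hilbertSnd_diag, e c (hSM c hc), e c (hSM c hc), e y hy, e a ha, hx c hc]
  have com1 : ∀ d ∈ S, hilbertDiag d * P = P * hilbertDiag d := fun d hd =>
    starProjection_commute (inv1 d hd) (by rw [adjoint_hilbertDiag]; exact inv1 _ (hstar d hd))
  have com2 : ∀ d ∈ M.commutant, hilbertDiag d * P = P * hilbertDiag d := fun d hd =>
    starProjection_commute (inv2 d hd) (by rw [adjoint_hilbertDiag]; exact inv2 _ (star_mem hd))
  have entry : ∀ (p : WithLp 2 (H × H) →L[ℂ] H) (i : H →L[ℂ] WithLp 2 (H × H)),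
      (∀ d x, p (hilbertDiag d x) = d (p x)) → (∀ d s, hilbertDiag d (i s) = i (d s)) →
      ∃ μ : ℂ, ∀ s, p (P (i s)) = μ • s := fun p i hp hi => by
    have hd : ∀ d : H →L[ℂ] H, hilbertDiag d * P = P * hilbertDiag d →
        d * (p ∘L P ∘L i) = (p ∘L P ∘L i) * d := fun d hd => by
      ext s
      have := congrArg (fun T : WithLp 2 (H × H) →L[ℂ] WithLp 2 (H × H) => p (T (i s))) hd
      simpa [hp, hi] using this
    obtain ⟨μ, hμ⟩ := hM (p ∘L P ∘L i)
      (by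
        rw [← VonNeumannAlgebra.commutant_commutant M, VonNeumannAlgebra.mem_commutant_iff]
        exact fun d hdM => hd d (com2 d hdM))
      (hcomm _ fun d hdS => hd d (com1 d hdS))
    exact ⟨μ, fun s => congrArg (fun T : H →L[ℂ] H => T s) hμ⟩
  obtain ⟨p11, h11⟩ := entry hilbertFst hilbertInl hilbertFst_diag hilbertDiag_inl
  obtain ⟨p12, h12⟩ := entry hilbertFst hilbertInr hilbertFst_diag hilbertDiag_inr
  obtain ⟨p21, h21⟩ := entry hilbertSnd hilbertInl hilbertSnd_diag hilbertDiag_inl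
  obtain ⟨p22, h22⟩ := entry hilbertSnd hilbertInr hilbertSnd_diag hilbertDiag_inr
  have hmem : ∀ s, hilbertInl (a s) + hilbertInr (y s) ∈ L := fun s => by
    rw [hL]
    intro c hc
    simpa using congrArg (fun T : H →L[ℂ] H => T s) (h c hc)
  have hfix : ∀ s, P (hilbertInl (a s)) + P (hilbertInr (y s)) =
      hilbertInl (a s) + hilbertInr (y s) := fun s => by
    rw [← map_add]
    exact Submodule.starProjection_eq_self_iff.2 (hmem s)
  have f1 : ∀ s, p11 • a s + p12 • y s = a s := fun s => by
    simpa [h11, h12] using congrArg hilbertFst (hfix s)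
  have f2 : ∀ s, p21 • a s + p22 • y s = y s := fun s => by
    simpa [h21, h22] using congrArg hilbertSnd (hfix s)
  -- Fixing `(a s, y s)` gives `p11 a + p12 y = a` and `p21 a + p22 y = y`. One of these solves for
  -- `y` unless `p22 = 1` and `p12 = 0`; then `L` contains `0 ⊕ H`, so `a c = 0` for all `c ∈ S`,
  -- which `hsep` excludes.
  by_cases c1 : p22 = 1
  · by_cases c2 : p12 = 0
    · exfalso
      obtain ⟨c, hc, hac⟩ := hsep
      apply hac
      ext t
      have ht : hilbertInr t ∈ L := by
        rw [← Submodule.starProjection_eq_self_iff, ← hP, ← hilbertInl_fst_add (P (hilbertInr t)),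
          h12, h22, c1, c2]
        simp
      simpa using ((hL _).1 ht c hc).symm
    · refine ⟨(1 - p11) / p12, ?_⟩
      ext s
      have e : p12 • y s = (1 - p11) • a s := by
        rw [sub_smul, one_smul]
        exact eq_sub_of_add_eq' (f1 s)
      rw [smul_apply, div_eq_inv_mul, mul_smul, ← e, smul_smul, inv_mul_cancel₀ c2, one_smul]
  · have c1' : 1 - p22 ≠ 0 := sub_ne_zero.2 (Ne.symm c1)
    refine ⟨p21 / (1 - p22), ?_⟩
    ext s
    have e : (1 - p22) • y s = p21 • a s := by
      rw [sub_smul, one_smul]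
      exact (eq_sub_of_add_eq (f2 s)).symm
    rw [smul_apply, div_eq_inv_mul, mul_smul, ← e, smul_smul, inv_mul_cancel₀ c1', one_smul]

end Intertwine

/-! ### The trace vector and right multiplication in the GNS space -/

section TraceVector

variable {A : Type*} [NonUnitalCStarAlgebra A] [PartialOrder A] [StarOrderedRing A]

local notation "⟪" x ", " y "⟫" => inner ℂ x y

/-- The class of `a` in the GNS Hilbert space. -/
def gnsCls (τ : A →ₚ[ℂ] ℂ) : A →ₗ[ℂ] τ.GNS :=
  (UniformSpace.Completion.toComplL (𝕜 := ℂ) (E := τ.PreGNS)).toLinearMap ∘ₗ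
    τ.toPreGNS.toLinearMap

theorem gnsCls_apply (τ : A →ₚ[ℂ] ℂ) (a : A) :
    gnsCls τ a = ((τ.toPreGNS a : τ.PreGNS) : τ.GNS) := rfl

theorem denseRange_gnsCls (τ : A →ₚ[ℂ] ℂ) : DenseRange (gnsCls τ) := by
  have h : DenseRange ((↑) : τ.PreGNS → τ.GNS) := UniformSpace.Completion.denseRange_coe
  exact fun x => h x

theorem inner_gnsCls (τ : A →ₚ[ℂ] ℂ) (a b : A) : ⟪gnsCls τ a, gnsCls τ b⟫ = τ (star a * b) := by
  rw [gnsCls_apply, gnsCls_apply, UniformSpace.Completion.inner_coe]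
  rfl

theorem gnsHom_gnsCls (τ : A →ₚ[ℂ] ℂ) (a b : A) :
    τ.gnsNonUnitalStarAlgHom a (gnsCls τ b) = gnsCls τ (a * b) := by
  rw [gnsCls_apply, PositiveLinearMap.gnsNonUnitalStarAlgHom_apply_coe]
  rfl

theorem inner_gnsHom_star (τ : A →ₚ[ℂ] ℂ) (a : A) (u v : τ.GNS) :
    ⟪τ.gnsNonUnitalStarAlgHom (star a) u, v⟫ = ⟪u, τ.gnsNonUnitalStarAlgHom a v⟫ := by
  rw [map_star, ContinuousLinearMap.star_eq_adjoint, ContinuousLinearMap.adjoint_inner_left]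

theorem norm_gnsCls_sq (τ : A →ₚ[ℂ] ℂ) (a : A) :
    ((‖gnsCls τ a‖ ^ 2 : ℝ) : ℂ) = τ (star a * a) := by
  rw [← inner_gnsCls, inner_self_eq_norm_sq_to_K]
  simp

theorem gnsHom_mem_gnsVN (τ : A →ₚ[ℂ] ℂ) (a : A) : τ.gnsNonUnitalStarAlgHom a ∈ gnsVN τ := by
  have : τ.gnsNonUnitalStarAlgHom a ∈ ((gnsVN τ).toStarSubalgebra : Set _) := by
    rw [coe_gnsVN]
    exact Set.subset_centralizer_centralizer ⟨a, rfl⟩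
  exact this

theorem mem_commutant_gnsVN {τ : A →ₚ[ℂ] ℂ} {x : τ.GNS →L[ℂ] τ.GNS}
    (hx : ∀ a, τ.gnsNonUnitalStarAlgHom a * x = x * τ.gnsNonUnitalStarAlgHom a) :
    x ∈ (gnsVN τ).commutant := by
  rw [VonNeumannAlgebra.mem_commutant_iff]
  intro g hg
  have hg' : g ∈ ((gnsVN τ).toStarSubalgebra : Set _) := hg
  rw [coe_gnsVN] at hg'
  refine (hg' x ?_).symm
  rintro _ ⟨a, rfl⟩
  exact hx a

section Trace

variable {τ : A →ₚ[ℂ] ℂ} (hτ : IsTracialState τ.toLinearMap)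

include hτ

theorem IsTracialState.norm_gnsCls_star (a : A) : ‖gnsCls τ (star a)‖ = ‖gnsCls τ a‖ := by
  have h : ((‖gnsCls τ (star a)‖ ^ 2 : ℝ) : ℂ) = ((‖gnsCls τ a‖ ^ 2 : ℝ) : ℂ) := by
    rw [norm_gnsCls_sq, norm_gnsCls_sq, star_star]
    exact hτ.trace _ _
  exact (sq_eq_sq₀ (norm_nonneg _) (norm_nonneg _)).1 (by exact_mod_cast h)

omit [StarOrderedRing A] in
theorem IsTracialState.norm_apply_le (a : A) : ‖τ a‖ ≤ ‖a‖ := by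
  rcases eq_or_ne a 0 with rfl | ha
  · simp
  have hn : ‖a‖ ≠ 0 := norm_ne_zero_iff.2 ha
  have := hτ.norm_eq_one.1 ⟨((‖a‖⁻¹ : ℝ) : ℂ) • a, by
    rw [norm_smul, Complex.norm_real, norm_inv, norm_norm, inv_mul_cancel₀ hn], rfl⟩
  rw [map_smul, norm_smul, Complex.norm_real, norm_inv, norm_norm, inv_mul_le_iff₀ (by positivity),
    mul_one] at this
  exact this

theorem IsTracialState.norm_gnsCls_le (a : A) : ‖gnsCls τ a‖ ≤ ‖a‖ := by
  rw [← sq_le_sq₀ (norm_nonneg _) (norm_nonneg _)]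
  have h1 : ‖gnsCls τ a‖ ^ 2 = ‖τ (star a * a)‖ := by
    rw [← norm_gnsCls_sq, Complex.norm_real, Real.norm_of_nonneg (by positivity)]
  rw [h1, sq, ← CStarRing.norm_star_mul_self]
  exact hτ.norm_apply_le _

/-- Since `A` may lack a unit, Cauchy–Schwarz is applied to `τ(u a)` along an approximate unit. The
bound makes `τ` extend to the GNS space, where Riesz representation gives a vector playing the role
of the class of `1`. -/
theorem IsTracialState.norm_apply_le_gnsCls (a : A) : ‖τ a‖ ≤ 1 * ‖gnsCls τ a‖ := by
  have hl := CStarAlgebra.increasingApproximateUnit A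
  have hcont : Continuous τ :=
    AddMonoidHomClass.continuous_of_bound τ 1 fun a => by simpa using hτ.norm_apply_le a
  have ht : Filter.Tendsto (fun u => ‖τ (u * a)‖) (CStarAlgebra.approximateUnit A)
      (nhds ‖τ a‖) :=
    ((hcont.tendsto a).comp (hl.tendsto_mul_right a)).norm
  have := hl.neBot
  refine le_of_tendsto ht ?_
  filter_upwards [hl.eventually_star_eq, hl.eventually_nnnorm] with u hu hu1
  rw [← hu, ← inner_gnsCls]
  refine (norm_inner_le_norm _ _).trans ?_
  gcongr
  exact (hτ.norm_gnsCls_le u).trans hu1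

theorem IsTracialState.exists_traceVector : ∃ ξ : τ.GNS, ∀ a, ⟪ξ, gnsCls τ a⟫ = τ a := by
  let f : τ.GNS →L[ℂ] ℂ := τ.toLinearMap.extendOfNorm (gnsCls τ)
  refine ⟨(InnerProductSpace.toDual ℂ τ.GNS).symm f, fun a => ?_⟩
  rw [InnerProductSpace.toDual_symm_apply]
  exact LinearMap.extendOfNorm_eq (denseRange_gnsCls τ) ⟨1, hτ.norm_apply_le_gnsCls⟩ a

/-- Right multiplication on the GNS Hilbert space of a trace. -/
theorem IsTracialState.exists_rightMul (b : A) :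
    ∃ R : τ.GNS →L[ℂ] τ.GNS, ∀ a, R (gnsCls τ a) = gnsCls τ (a * b) := by
  let f : A →ₗ[ℂ] τ.GNS := gnsCls τ ∘ₗ LinearMap.mulRight ℂ b
  refine ⟨f.extendOfNorm (gnsCls τ), LinearMap.extendOfNorm_eq (denseRange_gnsCls τ)
    ⟨‖τ.gnsNonUnitalStarAlgHom (star b)‖, fun a => ?_⟩⟩
  change ‖gnsCls τ (a * b)‖ ≤ _
  -- For a trace the involution is isometric on classes, which turns right multiplication by `b`
  -- into left multiplication by `b*`.
  rw [← hτ.norm_gnsCls_star, star_mul, ← gnsHom_gnsCls, ← hτ.norm_gnsCls_star a]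
  exact ContinuousLinearMap.le_opNorm _ _

/-- Right multiplication by `b` on the GNS Hilbert space of a trace. -/
def rightMul (b : A) : τ.GNS →L[ℂ] τ.GNS := (hτ.exists_rightMul b).choose

theorem rightMul_gnsCls (b a : A) : rightMul hτ b (gnsCls τ a) = gnsCls τ (a * b) :=
  (hτ.exists_rightMul b).choose_spec a

theorem rightMul_mem_commutant (b : A) : rightMul hτ b ∈ (gnsVN τ).commutant := by
  refine mem_commutant_gnsVN fun a => ?_
  ext u
  refine (denseRange_gnsCls τ).induction_on u (isClosed_eq (by fun_prop) (by fun_prop)) fun c => ?_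
  rw [mul_apply_eq_comp, mul_apply_eq_comp, rightMul_gnsCls, gnsHom_gnsCls, gnsHom_gnsCls,
    rightMul_gnsCls, mul_assoc]

theorem inner_rightMul_star (b : A) (u v : τ.GNS) :
    ⟪rightMul hτ (star b) u, v⟫ = ⟪u, rightMul hτ b v⟫ := by
  refine (denseRange_gnsCls τ).induction_on₂ (isClosed_eq (by fun_prop) (by fun_prop))
    (fun a c => ?_) u v
  rw [rightMul_gnsCls, rightMul_gnsCls, inner_gnsCls, inner_gnsCls, star_mul, star_star, mul_assoc,
    ← mul_assoc (star a)]
  exact hτ.trace _ _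

omit hτ in
theorem ext_inner_gnsCls {τ : A →ₚ[ℂ] ℂ} {u v : τ.GNS}
    (h : ∀ a, ⟪u, gnsCls τ a⟫ = ⟪v, gnsCls τ a⟫) : u = v :=
  ext_inner_right ℂ fun w => (denseRange_gnsCls τ).induction_on w
    (isClosed_eq (by fun_prop) (by fun_prop)) h

variable {ξ : τ.GNS} (hξ : ∀ a, ⟪ξ, gnsCls τ a⟫ = τ a)

include hξ

omit hτ in
theorem gnsHom_traceVector (b : A) : τ.gnsNonUnitalStarAlgHom b ξ = gnsCls τ b := by
  refine ext_inner_gnsCls fun a => ?_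
  conv_lhs => rw [← star_star b]
  rw [inner_gnsHom_star, gnsHom_gnsCls, hξ, inner_gnsCls]

theorem rightMul_traceVector (b : A) : rightMul hτ b ξ = gnsCls τ b := by
  refine ext_inner_gnsCls fun a => ?_
  conv_lhs => rw [← star_star b]
  rw [inner_rightMul_star, rightMul_gnsCls, hξ, inner_gnsCls]
  exact hτ.trace _ _

theorem apply_gnsCls_eq {x : τ.GNS →L[ℂ] τ.GNS} (hx : x ∈ gnsVN τ) (a : A) :
    x (gnsCls τ a) = rightMul hτ a (x ξ) := by
  rw [← rightMul_traceVector hτ hξ]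
  exact congrArg (fun T : τ.GNS →L[ℂ] τ.GNS => T ξ)
    (VonNeumannAlgebra.mem_commutant_iff.1 (rightMul_mem_commutant hτ a) x hx)

/-- The trace vector is separating for `π_τ(A)''`. -/
theorem eq_zero_of_apply_traceVector {x : τ.GNS →L[ℂ] τ.GNS} (hx : x ∈ gnsVN τ)
    (h0 : x ξ = 0) : x = 0 := by
  ext u
  refine (denseRange_gnsCls τ).induction_on u (isClosed_eq (by fun_prop) (by fun_prop)) fun a => ?_
  rw [apply_gnsCls_eq hτ hξ hx, h0, map_zero]
  rfl

theorem norm_star_apply_traceVector_le {x : τ.GNS →L[ℂ] τ.GNS} (hx : x ∈ gnsVN τ) :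
    ‖star x ξ‖ ≤ ‖x ξ‖ := by
  -- On a class, `⟨[a], x* ξ⟩ = ⟨R_a x ξ, ξ⟩ = ⟨x ξ, [a*]⟩`, where `R_a` is right multiplication,
  -- and `‖[a*]‖ = ‖[a]‖`.
  have key : ∀ u, ‖⟪u, star x ξ⟫‖ ≤ ‖x ξ‖ * ‖u‖ := fun u => by
    refine (denseRange_gnsCls τ).induction_on u (isClosed_le (by fun_prop) (by fun_prop))
      fun a => ?_
    rw [ContinuousLinearMap.star_eq_adjoint, ContinuousLinearMap.adjoint_inner_right,
      apply_gnsCls_eq hτ hξ hx]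
    conv_lhs => rw [← star_star a]
    rw [inner_rightMul_star, rightMul_traceVector hτ hξ, ← hτ.norm_gnsCls_star a]
    exact norm_inner_le_norm _ _
  have := key (star x ξ)
  rw [inner_self_eq_norm_sq_to_K, norm_pow, RCLike.norm_ofReal, abs_norm, sq] at this
  rcases (norm_nonneg (star x ξ)).eq_or_lt with h | h
  · rw [← h]; positivity
  · exact le_of_mul_le_mul_right this h

theorem norm_star_apply_traceVector {x : τ.GNS →L[ℂ] τ.GNS} (hx : x ∈ gnsVN τ) :
    ‖star x ξ‖ = ‖x ξ‖ := by
  refine le_antisymm (norm_star_apply_traceVector_le hτ hξ hx) ?_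
  simpa using norm_star_apply_traceVector_le hτ hξ (star_mem hx)

theorem trace_apply_of_mem_center {z : τ.GNS →L[ℂ] τ.GNS} (hz : z ∈ gnsVN τ)
    (hz' : z ∈ (gnsVN τ).commutant) (a b : A) :
    ⟪ξ, z (gnsCls τ (a * b))⟫ = ⟪ξ, z (gnsCls τ (b * a))⟫ := by
  have hc : ∀ c u, z (τ.gnsNonUnitalStarAlgHom c u) = τ.gnsNonUnitalStarAlgHom c (z u) :=
    fun c u => congrArg (fun T : τ.GNS →L[ℂ] τ.GNS => T u)
      (VonNeumannAlgebra.mem_commutant_iff.1 hz' _ (gnsHom_mem_gnsVN τ c)).symm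
  rw [← gnsHom_gnsCls τ a, hc, ← inner_gnsHom_star, gnsHom_traceVector hξ,
    apply_gnsCls_eq hτ hξ hz, ← inner_rightMul_star, rightMul_gnsCls, ← star_mul,
    ← gnsHom_traceVector hξ (b * a), hc, ← inner_gnsHom_star, gnsHom_traceVector hξ]

end Trace

/-! ### Uniqueness of the trace makes `π_τ(A)''` a factor -/

section Monotracial

/-- A positive bounded tracial functional on a monotracial algebra is a multiple of the trace. -/
theorem IsMonotracial.exists_eq_mul_tau (hA : IsMonotracial A) (f : A →ₗ[ℂ] ℂ) {C : ℝ}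
    (hC : ∀ b, ‖f b‖ ≤ C * ‖b‖) (hpos : ∀ b, 0 ≤ f (star b * b))
    (htr : ∀ a b, f (a * b) = f (b * a)) : ∃ r : ℝ, ∀ b, f b = r * hA.tau b := by
  let S : Set ℝ := {r | ∃ b : A, ‖b‖ ≤ 1 ∧ ‖f b‖ = r}
  have hC' : ∀ b, ‖f b‖ ≤ |C| * ‖b‖ := fun b =>
    (hC b).trans (mul_le_mul_of_nonneg_right (le_abs_self C) (norm_nonneg b))
  have hbdd : BddAbove S := ⟨|C|, by
    -- `r`, the norm of `f`, is the only possible factor: if it is non-zero then `r⁻¹ f` is a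
    -- tracial state, otherwise `f = 0`.
    rintro _ ⟨b, hb, rfl⟩
    exact (hC' b).trans (mul_le_of_le_one_right (abs_nonneg C) hb)⟩
  have hne : S.Nonempty := ⟨0, 0, by simp, by simp⟩
  have hlub := isLUB_csSup hne hbdd
  set r := sSup S with hr
  have hr0 : 0 ≤ r := hlub.1 ⟨0, by simp, by simp⟩
  have hpos' : ∀ b : A, 0 ≤ b → 0 ≤ f b := fun b hb => by
    obtain ⟨c, rfl⟩ := CStarAlgebra.nonneg_iff_eq_star_mul_self.1 hb
    exact hpos c
  refine ⟨r, fun b => ?_⟩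
  rcases hr0.eq_or_lt with h0 | h0
  · rw [← h0, Complex.ofReal_zero, zero_mul]
    rcases eq_or_ne b 0 with rfl | hb
    · simp
    have hn : ‖b‖ ≠ 0 := norm_ne_zero_iff.2 hb
    have h1 : ‖f (((‖b‖⁻¹ : ℝ) : ℂ) • b)‖ ≤ 0 := by
      rw [h0]
      refine hlub.1 ⟨_, ?_, rfl⟩
      rw [norm_smul, Complex.norm_real, norm_inv, norm_norm, inv_mul_cancel₀ hn]
    rw [norm_le_zero_iff, map_smul, smul_eq_zero] at h1
    refine h1.resolve_left ?_
    exact_mod_cast inv_ne_zero hn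
  · let ρ : A →ₚ[ℂ] ℂ := PositiveLinearMap.mk₀ (((r⁻¹ : ℝ) : ℂ) • f) fun x hx => by
      have h1 : (0 : ℂ) ≤ ((r⁻¹ : ℝ) : ℂ) := by exact_mod_cast inv_nonneg.2 hr0
      exact mul_nonneg h1 (hpos' x hx)
    have hρa : ∀ x, ρ x = ((r⁻¹ : ℝ) : ℂ) * f x := fun x => rfl
    have hρ : IsTracialState ρ.toLinearMap := by
      refine ⟨fun x => ?_, ⟨?_, fun B hB => ?_⟩, fun a c => ?_⟩
      · exact map_nonneg ρ (star_mul_self_nonneg x)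
      · rintro _ ⟨c, hc, rfl⟩
        change ‖ρ c‖ ≤ 1
        rw [hρa, norm_mul, Complex.norm_real, norm_inv, Real.norm_of_nonneg hr0,
          inv_mul_le_iff₀ h0, mul_one]
        exact hlub.1 ⟨c, hc, rfl⟩
      · have : r ≤ r * B := hlub.2 (by
          rintro _ ⟨c, hc, rfl⟩
          have := hB ⟨c, hc, rfl⟩
          change ‖ρ c‖ ≤ B at this
          rwa [hρa, norm_mul, Complex.norm_real, norm_inv, Real.norm_of_nonneg hr0,
            inv_mul_le_iff₀ h0] at this)
        exact le_of_mul_le_mul_left (by simpa using this) h0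
      · change ρ _ = ρ _
        rw [hρa, hρa, htr]
    have h2 : ρ = hA.tau := hA.1.unique hρ hA.tau_isTracialState
    rw [← h2, hρa, ← mul_assoc, ← Complex.ofReal_mul, mul_inv_cancel₀ h0.ne', Complex.ofReal_one,
      one_mul]

/-- The functional `a ↦ ⟨ξ, z π(a) ξ⟩` is a bounded positive trace, hence equals `r τ`. Thus `z ξ =
r ξ`, and `ξ` is separating. -/
theorem IsMonotracial.exists_eq_smul_one_of_isPositive (hA : IsMonotracial A)
    {z : hA.tau.GNS →L[ℂ] hA.tau.GNS} (hz : z ∈ gnsVN hA.tau)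
    (hz' : z ∈ (gnsVN hA.tau).commutant) (hp : z.IsPositive) : ∃ c : ℂ, z = c • 1 := by
  have hτ := hA.tau_isTracialState
  obtain ⟨ξ, hξ⟩ := hτ.exists_traceVector
  have hc : ∀ c u, z (hA.tau.gnsNonUnitalStarAlgHom c u) = hA.tau.gnsNonUnitalStarAlgHom c (z u) :=
    fun c u => congrArg (fun T : hA.tau.GNS →L[ℂ] hA.tau.GNS => T u)
      (VonNeumannAlgebra.mem_commutant_iff.1 hz' _ (gnsHom_mem_gnsVN hA.tau c)).symm
  have hsym : ∀ u v : hA.tau.GNS, ⟪z u, v⟫ = ⟪u, z v⟫ := fun u v => hp.isSymmetric u v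
  let f : A →ₗ[ℂ] ℂ := ((innerSL ℂ ξ) ∘L z).toLinearMap ∘ₗ gnsCls hA.tau
  have hf : ∀ b, f b = ⟪ξ, z (gnsCls hA.tau b)⟫ := fun b => rfl
  obtain ⟨r, hr⟩ := hA.exists_eq_mul_tau f (C := ‖z ξ‖)
    (fun b => by
      rw [hf, ← hsym]
      refine (norm_inner_le_norm _ _).trans ?_
      gcongr
      exact hτ.norm_gnsCls_le b)
    (fun b => by
      rw [hf, ← gnsHom_gnsCls, hc, ← inner_gnsHom_star, star_star, gnsHom_traceVector hξ]
      exact hp.inner_nonneg_right _)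
    (fun a b => trace_apply_of_mem_center hτ hξ hz hz' a b)
  refine ⟨r, sub_eq_zero.1 (eq_zero_of_apply_traceVector hτ hξ
    (sub_mem hz ((gnsVN hA.tau).toStarSubalgebra.smul_mem (one_mem _) _)) ?_)⟩
  have : z ξ = (r : ℂ) • ξ := ext_inner_gnsCls fun a => by
    rw [hsym, ← hf, hr, inner_smul_left, hξ, Complex.conj_ofReal]
  rw [sub_apply, this]
  simp

theorem IsMonotracial.hasTrivialCenter (hA : IsMonotracial A) :
    HasTrivialCenter (gnsVN hA.tau) := by
  have hsa : ∀ z ∈ gnsVN hA.tau, z ∈ (gnsVN hA.tau).commutant → star z = z →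
      ∃ c : ℂ, z = c • 1 := fun z hz hz' hs => by
    have h1 : ((‖z‖ : ℝ) : ℂ) • (1 : hA.tau.GNS →L[ℂ] hA.tau.GNS) ∈ gnsVN hA.tau :=
      (gnsVN hA.tau).toStarSubalgebra.smul_mem (one_mem _) _
    have h2 : ((‖z‖ : ℝ) : ℂ) • (1 : hA.tau.GNS →L[ℂ] hA.tau.GNS) ∈ (gnsVN hA.tau).commutant :=
      (gnsVN hA.tau).commutant.toStarSubalgebra.smul_mem (one_mem _) _
    -- A self-adjoint central element becomes positive after adding `‖z‖`; general elements are then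
    -- split into real and imaginary parts.
    obtain ⟨c, hc⟩ := hA.exists_eq_smul_one_of_isPositive (add_mem hz h1) (add_mem hz' h2) (by
      rw [ContinuousLinearMap.isPositive_def]
      refine ⟨?_, fun u => ?_⟩
      · rw [← ContinuousLinearMap.isSelfAdjoint_iff_isSymmetric, IsSelfAdjoint, star_add, hs,
          star_smul, star_one, Complex.star_def, Complex.conj_ofReal]
      · have h3 : |(⟪z u, u⟫).re| ≤ ‖z‖ * ‖u‖ * ‖u‖ :=
          (Complex.abs_re_le_norm _).trans ((norm_inner_le_norm _ _).trans (by
            gcongr; exact z.le_opNorm u))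
        have h4 : ContinuousLinearMap.reApplyInnerSelf
            (z + ((‖z‖ : ℝ) : ℂ) • (1 : hA.tau.GNS →L[ℂ] hA.tau.GNS)) u =
            (⟪z u, u⟫).re + ‖z‖ * ‖u‖ * ‖u‖ := by
          rw [ContinuousLinearMap.reApplyInnerSelf_apply, add_apply, inner_add_left, smul_apply,
            one_apply_eq_self, inner_smul_left, Complex.conj_ofReal, map_add, mul_assoc]
          congr 1
          rw [RCLike.re_to_complex, Complex.re_ofReal_mul]
          congr 1
          exact (inner_self_eq_norm_mul_norm (𝕜 := ℂ) u)
        rw [h4]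
        linarith [neg_abs_le (⟪z u, u⟫).re])
    exact ⟨c - ‖z‖, by rw [sub_smul, ← hc, add_sub_cancel_right]⟩
  intro z hz hz'
  obtain ⟨c, hc⟩ := hsa (z + star z) (add_mem hz (star_mem hz)) (add_mem hz' (star_mem hz'))
    (by rw [star_add, star_star, add_comm])
  obtain ⟨d, hd⟩ := hsa (Complex.I • (z - star z))
    ((gnsVN hA.tau).toStarSubalgebra.smul_mem (sub_mem hz (star_mem hz)) _)
    ((gnsVN hA.tau).commutant.toStarSubalgebra.smul_mem (sub_mem hz' (star_mem hz')) _)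
    (by
      rw [star_smul, star_sub, star_star, Complex.star_def, Complex.conj_I, neg_smul, ← smul_neg,
        neg_sub])
  refine ⟨(c - Complex.I * d) / 2, ?_⟩
  have e : (2 : ℂ) • z = (z + star z) - Complex.I • Complex.I • (z - star z) := by
    rw [smul_smul, Complex.I_mul_I]
    module
  rw [div_eq_inv_mul, mul_smul, sub_smul, mul_smul, ← hc, ← hd, ← e, smul_smul]
  norm_num

/-- The GNS representation of the trace of a simple algebra is faithful. -/
theorem IsSimpleCStar.gnsHom_injective (hs : IsSimpleCStar A) {τ : A →ₚ[ℂ] ℂ}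
    (hτ : IsTracialState τ.toLinearMap) : Function.Injective τ.gnsNonUnitalStarAlgHom := by
  let I : TwoSidedIdeal A := TwoSidedIdeal.mk' {a | τ.gnsNonUnitalStarAlgHom a = 0} (map_zero _)
    (fun {x y} hx hy => by
      simp only [Set.mem_ofPred_eq] at *
      rw [map_add, hx, hy, add_zero])
    (fun {x} hx => by
      simp only [Set.mem_ofPred_eq] at *
      rw [map_neg, hx, neg_zero])
    (fun {x y} hx => by
      simp only [Set.mem_ofPred_eq] at *
      rw [map_mul, hx, mul_zero])
    (fun {x y} hx => by
      simp only [Set.mem_ofPred_eq] at *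
      rw [map_mul, hx, zero_mul])
  have hI : ∀ a, a ∈ I ↔ τ.gnsNonUnitalStarAlgHom a = 0 := fun a =>
    TwoSidedIdeal.mem_mk' _ _ _ _ _ _ _
  have hcl : IsClosed (I : Set A) := by
    have : (I : Set A) = {a | τ.gnsNonUnitalStarAlgHom a = 0} := by
      ext a; exact hI a
    rw [this]
    exact isClosed_eq (map_continuous _) continuous_const
  rw [injective_iff_map_eq_zero]
  intro a ha
  rcases hs.2 I hcl with h | h
  · have := (hI a).2 ha
    rwa [h, TwoSidedIdeal.mem_bot] at this
  · exfalso
    obtain ⟨ξ, hξ⟩ := hτ.exists_traceVector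
    have h0 : ∀ b, τ b = 0 := fun b => by
      have hb : τ.gnsNonUnitalStarAlgHom b = 0 := (hI b).1 (by rw [h]; trivial)
      rw [← hξ, ← gnsHom_traceVector hξ, hb]
      simp
    have := hτ.norm_eq_one.2 (show (0 : ℝ) ∈ upperBounds _ by
      rintro _ ⟨b, -, rfl⟩
      change ‖τ b‖ ≤ 0
      rw [h0, norm_zero])
    linarith

end Monotracial

end TraceVector

/-! ### From unitaries normalising `π(A)` to unitary multipliers -/

section Multiplier

variable {A : Type*} [NonUnitalCStarAlgebra A]
variable {H : Type*} [NormedAddCommGroup H] [InnerProductSpace ℂ H] [CompleteSpace H]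

/-- A unitary `W` on `H` with `W π(A) ⊆ π(A)` and `W π(a) W* = π(σ a)`, for a faithful
representation `π`, gives a unitary multiplier implementing `σ`. -/
theorem exists_unitary_multiplier {π : A →⋆ₙₐ[ℂ] (H →L[ℂ] H)} (hπ : Function.Injective π)
    (σ : A ≃⋆ₐ[ℂ] A) {W : H →L[ℂ] H} (hW : star W * W = 1) (hW' : W * star W = 1)
    (hσ : ∀ a, W * π a = π (σ a) * W) (hL : ∀ a, ∃ b, W * π a = π b) :
    ∃ u ∈ unitary (DoubleCentralizer ℂ A), ∀ a : A,
      DoubleCentralizer.coe ℂ (σ a) = u * DoubleCentralizer.coe ℂ a * star u := by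
  choose l hl using hL
  have hnorm : ∀ a, ‖π a‖ = ‖a‖ := fun a => NonUnitalStarAlgHom.norm_map π hπ a
  let L : A →L[ℂ] A := LinearMap.mkContinuous
    { toFun := l
      map_add' := fun a b => hπ (by rw [← hl, map_add, map_add, mul_add, hl, hl])
      map_smul' := fun c a => hπ (by
        rw [← hl, map_smul, mul_smul_comm, hl, RingHom.id_apply, map_smul]) }
    ‖W‖ (fun a => by
      change ‖l a‖ ≤ _
      rw [← hnorm, ← hl, ← hnorm a]
      exact norm_mul_le _ _)
  have hL : ∀ a, π (L a) = W * π a := fun a => (hl a).symm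
  -- Right multiplication by `W` also preserves `π(A)`, since `π(a) W = W π(σ⁻¹ a)`.
  let R : A →L[ℂ] A := LinearMap.mkContinuous
    { toFun := fun a => l (σ.symm a)
      map_add' := fun a b => hπ (by simp only [← hl, map_add, mul_add])
      map_smul' := fun c a => hπ (by
        simp only [← hl, map_smul, mul_smul_comm, RingHom.id_apply]) }
    ‖W‖ (fun a => by
      change ‖l (σ.symm a)‖ ≤ _
      rw [← hnorm, ← hl, ← StarAlgEquiv.norm_map σ.symm a, ← hnorm (σ.symm a)]
      exact norm_mul_le _ _)
  have hR : ∀ a, π (R a) = π a * W := fun a => by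
    change π (l (σ.symm a)) = _
    rw [← hl, hσ, StarAlgEquiv.apply_symm_apply]
  let u : DoubleCentralizer ℂ A :=
    { toProd := (L, R)
      central := fun x y => hπ (by
        change π (R x * y) = π (x * L y)
        rw [map_mul, map_mul, hL, hR, mul_assoc]) }
  have ext : ∀ m n : DoubleCentralizer ℂ A, (∀ x, π (m.fst x) = π (n.fst x)) →
      (∀ x, π (m.snd x) = π (n.snd x)) → m = n := fun m n h1 h2 =>
    DoubleCentralizer.ext ℂ A m n (Prod.ext (ContinuousLinearMap.ext fun x => hπ (h1 x))
      (ContinuousLinearMap.ext fun x => hπ (h2 x)))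
  have u1 : ∀ x, π (u.fst x) = W * π x := hL
  have u2 : ∀ x, π (u.snd x) = π x * W := hR
  have u3 : ∀ x, π ((star u).fst x) = star W * π x := fun x => by
    rw [DoubleCentralizer.star_fst, map_star, u2, map_star, star_mul, star_star]
  have u4 : ∀ x, π ((star u).snd x) = π x * star W := fun x => by
    rw [DoubleCentralizer.star_snd, map_star, u1, map_star, star_mul, star_star]
  refine ⟨u, Unitary.mem_iff.2 ⟨ext _ _ (fun x => ?_) fun x => ?_,
    ext _ _ (fun x => ?_) fun x => ?_⟩, fun a => ext _ _ (fun x => ?_) fun x => ?_⟩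
  · rw [DoubleCentralizer.mul_fst, mul_apply_eq_comp, u3, u1, ← mul_assoc, hW, one_mul]
    rfl
  · rw [DoubleCentralizer.mul_snd, mul_apply_eq_comp, u2, u4, mul_assoc, hW, mul_one]
    rfl
  · rw [DoubleCentralizer.mul_fst, mul_apply_eq_comp, u1, u3, ← mul_assoc, hW', one_mul]
    rfl
  · rw [DoubleCentralizer.mul_snd, mul_apply_eq_comp, u4, u2, mul_assoc, hW', mul_one]
    rfl
  · rw [DoubleCentralizer.mul_fst, DoubleCentralizer.mul_fst, mul_apply_eq_comp,
      mul_apply_eq_comp, u1, DoubleCentralizer.coe_fst, DoubleCentralizer.coe_fst,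
      ContinuousLinearMap.mul_apply', ContinuousLinearMap.mul_apply', map_mul, map_mul, u3,
      ← mul_assoc, ← mul_assoc, hσ, mul_assoc (π (σ a)), hW', mul_one]
  · rw [DoubleCentralizer.mul_snd, DoubleCentralizer.mul_snd, mul_apply_eq_comp,
      mul_apply_eq_comp, u4, DoubleCentralizer.coe_snd, DoubleCentralizer.coe_snd,
      ContinuousLinearMap.flip_apply, ContinuousLinearMap.flip_apply,
      ContinuousLinearMap.mul_apply', ContinuousLinearMap.mul_apply', map_mul, map_mul, u2,
      mul_assoc (π x), hσ, mul_assoc, mul_assoc, hW', mul_one]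

/-- If `π(a₀) W* ∈ π(A)` for some non-zero `a₀` of a simple algebra, then `W π(A) ⊆ π(A)`. -/
theorem IsSimpleCStar.exists_mul_eq (hs : IsSimpleCStar A) {π : A →⋆ₙₐ[ℂ] (H →L[ℂ] H)}
    (hπ : Function.Injective π) (σ : A ≃⋆ₐ[ℂ] A) {W : H →L[ℂ] H} (hW : star W * W = 1)
    (hW' : W * star W = 1) (hσ : ∀ a, W * π a = π (σ a) * W) {a₀ : A} (ha₀ : a₀ ≠ 0)
    (h0 : ∃ b, π a₀ * star W = π b) (a : A) : ∃ b, W * π a = π b := by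
  have hσ' : ∀ y, π y * star W = star W * π (σ y) := fun y =>
    calc π y * star W = star W * (W * π y) * star W := by rw [← mul_assoc, hW, one_mul]
      _ = star W * π (σ y) := by rw [hσ, mul_assoc, mul_assoc, hW', mul_one]
  -- The elements `x` with `π(x) W* ∈ π(A)` absorb right factors because `π(y) W* = W* π(σ y)`, and
  -- they form a closed set because `π` is isometric. Simplicity makes this ideal everything, and
  -- adjoints give `W π(a) ∈ π(A)`.
  let I : TwoSidedIdeal A := TwoSidedIdeal.mk' {x | ∃ b, π x * star W = π b} ⟨0, by simp⟩
    (by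
      rintro x y ⟨b, hb⟩ ⟨c, hc⟩
      exact ⟨b + c, by rw [map_add, add_mul, hb, hc, map_add]⟩)
    (by
      rintro x ⟨b, hb⟩
      exact ⟨-b, by rw [map_neg, neg_mul, hb, map_neg]⟩)
    (by
      rintro x y ⟨b, hb⟩
      exact ⟨x * b, by rw [map_mul, mul_assoc, hb, map_mul]⟩)
    (by
      rintro x y ⟨b, hb⟩
      exact ⟨b * σ y, by rw [map_mul, mul_assoc, hσ', ← mul_assoc, hb, map_mul]⟩)
  have hI : ∀ x, x ∈ I ↔ ∃ b, π x * star W = π b := fun x =>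
    TwoSidedIdeal.mem_mk' _ _ _ _ _ _ _
  have hiso : Isometry π := NonUnitalStarAlgHom.isometry π hπ
  have hcl : IsClosed (I : Set A) := by
    have : (I : Set A) = (fun x => π x * star W) ⁻¹' Set.range π := by
      ext x
      exact (hI x).trans ⟨fun ⟨b, hb⟩ => ⟨b, hb.symm⟩, fun ⟨b, hb⟩ => ⟨b, hb.symm⟩⟩
    rw [this]
    exact hiso.isClosedEmbedding.isClosed_range.preimage (hiso.continuous.mul continuous_const)
  have htop : I = ⊤ := by
    refine (hs.2 I hcl).resolve_left fun h => ha₀ ?_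
    have := (hI a₀).2 h0
    rwa [h, TwoSidedIdeal.mem_bot] at this
  obtain ⟨b, hb⟩ := (hI (star a)).1 (by rw [htop]; trivial)
  refine ⟨star b, ?_⟩
  have := congrArg star hb
  rwa [star_mul, star_star, ← map_star, star_star, ← map_star] at this

end Multiplier

/-! ### Linear independence of implementing unitaries over `A` -/

section Independence

variable {A : Type*} [NonUnitalCStarAlgebra A] [PartialOrder A] [StarOrderedRing A]

/-- Unitaries of `π_τ(A)''` implementing the automorphisms of an outer action on a simple
monotracial algebra are linearly independent over `A`. -/
theorem IsMonotracial.eq_zero_of_sum_gnsHom_mul_eq_zero (hs : IsSimpleCStar A)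
    (hA : IsMonotracial A) {Γ : Type*} [Group Γ] {α : Γ →* (A ≃⋆ₐ[ℂ] A)} (hα : IsOuterAction α)
    {N : Subgroup Γ} [Fintype N] {V : N → hA.tau.GNS →L[ℂ] hA.tau.GNS}
    (hVM : ∀ h, V h ∈ gnsVN hA.tau) (hV : ∀ h, star (V h) * V h = 1)
    (hV' : ∀ h, V h * star (V h) = 1)
    (hcov : ∀ h a, V h * hA.tau.gnsNonUnitalStarAlgHom a =
      hA.tau.gnsNonUnitalStarAlgHom (α h a) * V h)
    (a : N → A) (ha : ∑ h, hA.tau.gnsNonUnitalStarAlgHom (a h) * V h = 0) : a = 0 := by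
  classical
  have hτ := hA.tau_isTracialState
  set π := hA.tau.gnsNonUnitalStarAlgHom with hπdef
  have hπ : Function.Injective π := hs.gnsHom_injective hτ
  have hπ0 : ∀ {x}, π x = 0 → x = 0 := fun {x} hx => (map_eq_zero_iff π hπ).1 hx
  have hcancel : ∀ (h : N) (x : A), π x * V h = 0 → x = 0 := fun h x hx => by
    apply hπ0
    rw [← mul_one (π x), ← hV' h, ← mul_assoc, hx, zero_mul]
  induction hn : (Finset.univ.filter fun h => a h ≠ 0).card using Nat.strong_induction_on
    generalizing a with
  | _ n ih =>
  by_contra hne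
  obtain ⟨h₀, h₀ne⟩ : ∃ h, a h ≠ 0 := Function.ne_iff.1 hne
  obtain ⟨h₁, h₁ne, h₁h₀⟩ : ∃ h, a h ≠ 0 ∧ h ≠ h₀ := by
    by_contra! hall
    refine h₀ne (hcancel h₀ _ ?_)
    rw [← ha, Finset.sum_eq_single h₀]
    · intro h _ hh
      have : a h = 0 := by
        by_contra h0
        exact hh (hall h h0)
      rw [this, map_zero, zero_mul]
    · simp
  set g : N := h₁ * h₀⁻¹ with hg
  have hrel : ∀ c, a h₀ * c * a h₁ = a h₁ * α g (c * a h₀) := fun c => by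
    -- Multiply the relation by `π(a_{h₀} c)` on the left and subtract its product with `π(x)` on
    -- the right. The choice `α_{h₀}(x) = c a_{h₀}` kills the coefficient at `h₀` and creates no new
    -- ones, so induction makes the coefficient at `h₁` vanish.
    let x : A := α (h₀⁻¹ : N) (c * a h₀)
    let b : N → A := fun h => a h₀ * c * a h - a h * α h x
    have hb : ∑ h, π (b h) * V h = 0 := by
      have e1 : ∀ h, π (b h) * V h = π (a h₀ * c) * (π (a h) * V h) - π (a h) * V h * π x :=
        fun h => by
          simp only [b]
          rw [map_sub, map_mul, map_mul _ (a h), sub_mul, mul_assoc, mul_assoc, mul_assoc, hcov]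
      rw [Finset.sum_congr rfl fun h _ => e1 h, Finset.sum_sub_distrib, ← Finset.mul_sum,
        ← Finset.sum_mul, ha, mul_zero, zero_mul, sub_zero]
    have hx : α (h₀ : Γ) x = c * a h₀ := by
      simp only [x]
      rw [← StarAlgEquiv.mul_apply, ← map_mul, Subgroup.coe_inv, mul_inv_cancel, map_one,
        StarAlgEquiv.one_apply]
    have hx' : α (h₁ : Γ) x = α g (c * a h₀) := by
      simp only [x, hg]
      rw [← StarAlgEquiv.mul_apply, ← map_mul, Subgroup.coe_mul]
    have hlt : (Finset.univ.filter fun h => b h ≠ 0).card < n := by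
      rw [← hn]
      refine Finset.card_lt_card (Finset.ssubset_iff_of_subset (fun h => ?_) |>.2 ⟨h₀, ?_, ?_⟩)
      · simp only [Finset.mem_filter, Finset.mem_univ, true_and]
        contrapose!
        intro h0
        simp [b, h0]
      · simpa using h₀ne
      · simp only [Finset.mem_filter, Finset.mem_univ, true_and, not_not, b]
        rw [hx, mul_assoc, sub_self]
    have := congrFun (ih _ hlt b hb rfl) h₁
    simp only [b] at this
    rw [hx'] at this
    exact sub_eq_zero.1 this
  -- With `y = π(a_{h₁}) V_g`, `hrel` becomes `y π(c) π(a_{h₀}) = π(a_{h₀}) π(c) y` for all `c`.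
  obtain ⟨μ, hμ⟩ := hA.hasTrivialCenter.eq_smul_of_forall_mul_mul_eq (S := Set.range π)
    (by rintro _ ⟨c, rfl⟩; exact gnsHom_mem_gnsVN _ c)
    (fun x hx => mem_commutant_gnsVN fun c => hx _ ⟨c, rfl⟩)
    (by rintro _ ⟨c, rfl⟩; exact ⟨star c, map_star π c⟩)
    (by rintro _ ⟨c, rfl⟩ _ ⟨d, rfl⟩; exact ⟨c * d, map_mul π c d⟩)
    (gnsHom_mem_gnsVN _ (a h₀)) (mul_mem (gnsHom_mem_gnsVN _ (a h₁)) (hVM g))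
    ⟨π (star (a h₀)), ⟨_, rfl⟩, fun h0 => h₀ne (by
      rw [← hπdef, ← map_mul] at h0
      exact CStarRing.mul_star_self_eq_zero_iff (a h₀) |>.1 (hπ0 h0))⟩
    (by
      rintro _ ⟨c, rfl⟩
      rw [← hπdef, mul_assoc, mul_assoc, ← map_mul, hcov, ← mul_assoc, ← map_mul, ← hrel, map_mul,
        map_mul, mul_assoc, mul_assoc])
  rw [← hπdef] at hμ
  have hμ0 : μ ≠ 0 := by
    rintro rfl
    rw [zero_smul] at hμ
    exact h₁ne (hcancel g _ hμ)
  have hmul : ∃ b, π (a h₀) * star (V g) = π b := by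
    refine ⟨μ⁻¹ • a h₁, ?_⟩
    have e : π (a h₀) = μ⁻¹ • (π (a h₁) * V g) := by
      rw [hμ, smul_smul, inv_mul_cancel₀ hμ0, one_smul]
    rw [e, smul_mul_assoc, mul_assoc, hV', mul_one, map_smul]
  have hout : (g : Γ) ∈ ({1} : Set Γ) := by
    rw [← hα]
    exact exists_unitary_multiplier hπ (α g) (hV g) (hV' g) (hcov g)
      (hs.exists_mul_eq hπ (α g) (hV g) (hV' g) (hcov g) h₀ne hmul)
  have : g = 1 := Subtype.ext hout
  exact h₁h₀ (mul_inv_eq_one.1 this)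

end Independence

/-! ### Tracial states and projections -/

section TracialState

variable {B : Type*} [NormedRing B] [StarRing B] [Algebra ℂ B] [StarModule ℂ B]

/-- The degenerate case of Cauchy–Schwarz: the quadratic term in `c` drops out of `φ((y + c x)* (y +
c x)) ≥ 0`, and a real affine function bounded below is constant. Hermitian symmetry of `φ` is not
part of the definition, so the values at `y* x` and `x* y` are treated separately and linked through
the imaginary parts. -/
theorem IsTracialState.apply_star_mul_eq_zero {φ : B →ₗ[ℂ] ℂ} (hφ : IsTracialState φ) {x : B}
    (hx : φ (star x * x) = 0) (y : B) : φ (star y * x) = 0 := by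
  have key : ∀ c : ℂ, 0 ≤ φ (star y * y) + c * φ (star y * x) + star c * φ (star x * y) :=
    fun c => by
      have := hφ.nonneg (y + c • x)
      simpa [add_mul, mul_add, hx, star_smul, ← add_assoc, add_right_comm] using this
  have k0 := Complex.nonneg_iff.1 (hφ.nonneg y)
  set γ := φ (star y * y)
  set β := φ (star y * x)
  set β' := φ (star x * y)
  have k1 := Complex.nonneg_iff.1 (key 1)
  have k2 := Complex.nonneg_iff.1 (key Complex.I)
  have k3 : ∀ s : ℝ, 0 ≤ γ.re + s * (β.re + β'.re) := fun s => by
    have := (Complex.nonneg_iff.1 (key s)).1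
    simp at this
    linarith
  have k4 : ∀ s : ℝ, 0 ≤ γ.re + s * (β'.im - β.im) := fun s => by
    have := (Complex.nonneg_iff.1 (key (s * Complex.I))).1
    simp at this
    linarith
  have lin : ∀ d : ℝ, (∀ s : ℝ, 0 ≤ γ.re + s * d) → d = 0 := fun d hd => by
    by_contra hd0
    have := hd (-(γ.re + 1) / d)
    rw [div_mul_cancel₀ _ hd0] at this
    linarith
  have l3 := lin _ k3
  have l4 := lin _ k4
  simp at k1 k2
  apply Complex.ext
  · rw [Complex.zero_re]; linarith [k2.2, k0.2]
  · rw [Complex.zero_im]; linarith [k1.2, k0.2]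

theorem IsTracialState.apply_one_ne_zero {φ : B →ₗ[ℂ] ℂ} (hφ : IsTracialState φ) : φ 1 ≠ 0 := by
  intro h
  have h0 : ∀ y, φ y = 0 := fun y => by
    simpa using hφ.apply_star_mul_eq_zero (x := 1) (by simpa using h) (star y)
  have := hφ.norm_eq_one.2 (show (0 : ℝ) ∈ upperBounds _ by
    rintro _ ⟨b, -, rfl⟩
    rw [h0, norm_zero])
  linarith

/-- If `φ(e) = 0`, Cauchy–Schwarz makes `φ` vanish on `Be`; the trace property moves `e` to the
right end of each term, so `φ(y_i* y_i) = 0` for all `i` and `φ(1) = 0`. -/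
theorem IsTracialState.apply_projection_ne_zero {φ : B →ₗ[ℂ] ℂ} (hφ : IsTracialState φ) {e : B}
    (hee : e * e = e) (hse : star e = e) {n : ℕ} {y : Fin n → B} (hey : ∀ i, e * y i = y i)
    (hsum : ∑ i, star (y i) * y i = 1) : φ e ≠ 0 := by
  intro h
  apply hφ.apply_one_ne_zero
  rw [← hsum, map_sum]
  refine Finset.sum_eq_zero fun i _ => ?_
  have h1 := hφ.apply_star_mul_eq_zero (x := e) (by rw [hse, hee, h]) (y i * star (y i))
  rw [hφ.trace, ← hey i, mul_assoc, hφ.trace, hey i]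
  rwa [star_mul, star_star] at h1

end TracialState

/-! ### The representation of the group algebra -/

section GroupAlgebraRep

variable {B : Type*} [NormedRing B] [StarRing B] [Algebra ℂ B] [StarModule ℂ B]
variable {N : Type*} [Group N]

omit [StarModule ℂ B] in
theorem groupAlgRep_eq_sum [Fintype N] (v : N →* unitary B) (p : MonoidAlgebra ℂ N) :
    groupAlgRep v p = ∑ h, p.coeff h • (v h : B) := by
  rw [groupAlgRep, MonoidAlgebra.lift_apply, Finsupp.sum_fintype]
  · rfl
  · simp

theorem star_groupAlgRep [Fintype N] (v : N →* unitary B) {p : MonoidAlgebra ℂ N}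
    (hp : IsGroupAlgProj p) : star (groupAlgRep v p) = groupAlgRep v p := by
  rw [groupAlgRep_eq_sum, star_sum, ← Equiv.sum_comp (Equiv.inv N) fun h => p.coeff h • (v h : B)]
  refine Finset.sum_congr rfl fun h _ => ?_
  rw [star_smul, Equiv.inv_apply, hp.2, map_inv]
  rfl

omit [StarModule ℂ B] in
theorem coe_groupAlgRep [Fintype N] {C : Type*} [NormedRing C] [StarRing C] [NormedAlgebra ℂ C]
    [StarModule ℂ C] {S : StarSubalgebra ℂ C} (v : N →* unitary S) (p : MonoidAlgebra ℂ N) :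
    ((groupAlgRep v p : S) : C) = ∑ h, p.coeff h • ((v h : S) : C) := by
  rw [groupAlgRep_eq_sum]
  exact map_sum S.subtype _ _

end GroupAlgebraRep

/-! ### Non-vanishing of traces on images of projections -/

section Support

variable {A : Type*} [NonUnitalCStarAlgebra A] [PartialOrder A] [StarOrderedRing A]

theorem Implements.mul_gnsHom {Γ : Type*} [CommGroup Γ] {τ : A →ₚ[ℂ] ℂ} {α : Γ →* (A ≃⋆ₐ[ℂ] A)}
    {h : ∀ g a, τ (α g a) = τ a} {g : Γ} {u : unitary (gnsVN τ).toStarSubalgebra}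
    (hu : Implements (inducedAction τ α h) u g) (a : A) :
    ((u : (gnsVN τ).toStarSubalgebra) : τ.GNS →L[ℂ] τ.GNS) * τ.gnsNonUnitalStarAlgHom a =
      τ.gnsNonUnitalStarAlgHom (α g a) * ((u : (gnsVN τ).toStarSubalgebra) : τ.GNS →L[ℂ] τ.GNS) := by
  have h1 := congrArg Subtype.val (hu ⟨_, gnsHom_mem_gnsVN τ a⟩)
  have h2 : τ.gnsNonUnitalStarAlgHom (α g a) =
      ((u : (gnsVN τ).toStarSubalgebra) : τ.GNS →L[ℂ] τ.GNS) * τ.gnsNonUnitalStarAlgHom a *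
        star ((u : (gnsVN τ).toStarSubalgebra) : τ.GNS →L[ℂ] τ.GNS) :=
    (gnsUnitary_conj τ (α g) (h g) a).symm.trans h1
  have h3 : star ((u : (gnsVN τ).toStarSubalgebra) : τ.GNS →L[ℂ] τ.GNS) *
      ((u : (gnsVN τ).toStarSubalgebra) : τ.GNS →L[ℂ] τ.GNS) = 1 :=
    congrArg Subtype.val (Unitary.star_mul_self_of_mem u.2)
  rw [h2, mul_assoc, h3, mul_one]

/-- A trace of `π_τ(A)''` does not vanish on the images of non-zero projections of `ℂN(α̃)`. -/
theorem IsMonotracial.apply_groupAlgRep_ne_zero (hs : IsSimpleCStar A) (hA : IsMonotracial A)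
    {Γ : Type*} [CommGroup Γ] {α : Γ →* (A ≃⋆ₐ[ℂ] A)} (hα : IsOuterAction α)
    {N : Subgroup Γ} [Fintype N] (v : N →* unitary (gnsVN hA.tau).toStarSubalgebra)
    (hv : ∀ h, Implements (inducedAction hA.tau α (fun g => hA.tau_invariant (α g))) (v h) (h : Γ))
    {φ : (gnsVN hA.tau).toStarSubalgebra →ₗ[ℂ] ℂ} (hφ : IsTracialState φ)
    {p : MonoidAlgebra ℂ N} (hp : IsGroupAlgProj p) (hp0 : p ≠ 0) : φ (groupAlgRep v p) ≠ 0 := by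
  set e := groupAlgRep v p with he
  have hee : e * e = e := by rw [he, ← map_mul, hp.1]
  have hse : star e = e := star_groupAlgRep v hp
  obtain ⟨ξ, hξ⟩ := hA.tau_isTracialState.exists_traceVector
  have he0 : (e : hA.tau.GNS →L[ℂ] hA.tau.GNS) ≠ 0 := by
    intro h
    have := hs.1
    obtain ⟨a, ha⟩ := exists_ne (0 : A)
    apply hp0
    -- Multiplying `∑ p_h v_h = 0` by `π(a)` turns it into a relation over `A` with coefficients
    -- `p_h a`, although `A` may have no unit.
    have key := hA.eq_zero_of_sum_gnsHom_mul_eq_zero hs hα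
      (V := fun k => ((v k : (gnsVN hA.tau).toStarSubalgebra) : hA.tau.GNS →L[ℂ] hA.tau.GNS))
      (fun k => (v k : (gnsVN hA.tau).toStarSubalgebra).2)
      (fun k => congrArg Subtype.val (Unitary.star_mul_self_of_mem (v k).2))
      (fun k => congrArg Subtype.val (Unitary.mul_star_self_of_mem (v k).2))
      (fun k => (hv k).mul_gnsHom) (fun k => p.coeff k • a) (by
        simp only [map_smul, smul_mul_assoc, ← mul_smul_comm, ← Finset.mul_sum]
        rw [← coe_groupAlgRep, ← he, h, mul_zero])
    ext k
    exact (smul_eq_zero.1 (congrFun key k)).resolve_right ha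
  obtain ⟨n, y, hyM, hey, hsum⟩ := hA.hasTrivialCenter.exists_sum_star_mul_eq_one
    (fun x hx => norm_star_apply_traceVector hA.tau_isTracialState hξ hx)
    e.2 (congrArg Subtype.val hee) (congrArg Subtype.val hse)
    (fun h => he0 (eq_zero_of_apply_traceVector hA.tau_isTracialState hξ e.2 h))
  refine hφ.apply_projection_ne_zero hee hse (y := fun i => ⟨y i, hyM i⟩)
    (fun i => Subtype.ext (hey i)) (Subtype.ext ?_)
  exact (map_sum (gnsVN hA.tau).toStarSubalgebra.subtype _ _).trans hsum

end Support

end OpAlg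

theorem proposition2p8 {A : Type*} [NonUnitalCStarAlgebra A] [PartialOrder A] [StarOrderedRing A]
    [TopologicalSpace.SeparableSpace A] (hsimple : OpAlg.IsSimpleCStar A)
    (hA : OpAlg.IsMonotracial A) {Γ : Type*} [CommGroup Γ] [Finite Γ]
    (α : Γ →* (A ≃⋆ₐ[ℂ] A)) (hα : OpAlg.IsOuterAction α)
    (hchar : OpAlg.HasTrivialCharInvariant
      (OpAlg.inducedAction hA.tau α (fun g => hA.tau_invariant (α g))))
    (m : PMF (OpAlg.MinProj (OpAlg.innerSubgroup
      (OpAlg.inducedAction hA.tau α (fun g => hA.tau_invariant (α g))))))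
    (hm : OpAlg.IsInnerInvariant
      (OpAlg.inducedAction hA.tau α (fun g => hA.tau_invariant (α g)))
      (Quotient.mk (OpAlg.measureSetoid _) m)) :
    ∀ p, 0 < m p := by
  intro p
  obtain ⟨τM, v, mv, hτM, hv, hmv, hcl⟩ := hm
  obtain ⟨η, hη⟩ := Quotient.exact hcl
  -- Since `m p` is the value of `m_v` at the twisted minimal projection, non-vanishing of `m_v` on
  -- all of `P_N` is enough.
  rw [hη p, pos_iff_ne_zero]
  intro h0
  have := Fintype.ofFinite (OpAlg.innerSubgroup
      (OpAlg.inducedAction hA.tau α (fun g => hA.tau_invariant (α g))))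
  refine hA.apply_groupAlgRep_ne_zero hsimple hα v hv hτM (p.twist η).2.1 (p.twist η).2.2.1 ?_
  rw [hmv, h0, ENNReal.toReal_zero, Complex.ofReal_zero]

end
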